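/- **Graphs.** A BM graph is a pair of finite sets $V$ (vertices), $F$ (flags) with a map $\partial:F\to V$ and an involution $j:F\to F$; the fixpoints of $j$ are called tails, their set is $T$; the two-element orbits of $j$ are the edges. A morphism $h:\tau\to\sigma$ of BM graphs is a triple $(h^F,h_V,j_h)$, with $h^F:F_\sigma\to F_\tau$ injective, $h_V:V_\tau\to V_\sigma$ surjective and $j_h$ a fixpoint-free involution of $F_\tau\setminus h^F(F_\sigma)$, such that: $h^F(F_\sigma)$ is $j_\tau$-invariant; $j_h$ agrees with $j_\tau$ on edges; $h_V(\partial_\tau h^F(f))=\partial_\sigma f$ for $f\in F_\sigma$; $h_V(\partial_\tau f)=h_V(\partial_\tau j_h f)$ for $f\notin h^F(F_\sigma)$; and $(h^F)^{-1}$ maps edges of $\tau$ contained in $h^F(F_\sigma)$ to edges of $\sigma$. The composite $c\circ g$ has $h_V=c_V\circ g_V$, $h^F=g^F\circ c^F$, and $j_h$ is $j_g$ on the complement of $g^F$ and $j_c$ on the complement of $c^F$. This is the category $\mathbf{BM}$. A *compression* is a morphism $h:\tau\to\sigma$ for which $h^F$ restricts to a bijection $T_\sigma\to T_\tau$; $\mathbf{BM}_{\rm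 comp}\subset\mathbf{BM}$ is the wide subcategory of compressions. A JK graph is a diagram of finite sets $A\xleftarrow{s}H\xrightarrow{p}V$ with $s$ injective, together with a fixpoint-free involution $i$ of $A$. An etale morphism is a triple of maps commuting with $i,s,p$ such that the square of the maps $p$ is a pullback; this gives the category $\mathbf{Gr}$. A port is an arc $a\in A$ not in the image of $s$; an edge $\{a,i(a)\}$ is isolated if both $a$ and $i(a)$ are ports; a graph is effective if it is nonempty and has no isolated edges. The elementary graphs are the unit graph $\mathsf I$ (one edge, no vertices) and, for every finite set $n$, the corolla $\mathsf n$ (one vertex, $H=n$, $A=n+n$, with $i$ interchanging the two copies of $n$ and $s$ the inclusion of one of them, so that the other one is the set of ports); $\mathbf{elGr}\subset\mathbf{Gr}$ is the full subcategory of elementary graphs. A graphical species is a presheaf on $\mathbf{elGr}$; graphs embed fully faithfully into species by $\mathsf X\mapsto\operatorname{Hom}_{\mathbf{Gr}}(-,\mathsf X)$, and for a species $F$ and a graph $\mathsf G$ one puts $F[\mathsf G]=\operatorname{Hom}(\mathsf G,F)$. **Monad.** For a finite set $n$, an effective $\mathsf n$-graph is an effective graph with a bijection between its set of ports and $n$.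 The monad $F\mapsto\overline F$ on graphical species has $\overline F[\mathsf I]=F[\mathsf I]$, and $\overline F[\mathsf n]$ is the set of isomorphism classes (isomorphisms fixing the ports and respecting decorations) of effective $\mathsf n$-graphs $\mathsf G$ decorated by an element of $F[\mathsf G]$. The unit regards an operation as a decorated corolla. The multiplication takes a graph $\mathsf G$ each of whose vertices $v$ is decorated by an $F$-decorated graph $\mathsf G_v$ with the same interface as $v$ to the colimit obtained by gluing the $\mathsf G_v$ in the same way as $\mathsf G$ is glued from its corollas. **Restricted Kleisli category.** $\widetilde{\mathbf{Gr}}$ is the full subcategory of the Kleisli category of this monad on the graphs without isolated edges; a morphism $\mathsf R\to\mathsf Y$ is thus a morphism of species $\mathsf R\to\overline{\mathsf Y}$. It assigns to each vertex $x$ of $\mathsf R$ an effective graph $\mathsf S_x\to\mathsf Y$ etale over $\mathsf Y$, with the same interface as $x$. Gluing the $\mathsf S_x$ in the way in which $\mathsf R$ is glued from its corollas gives a colimit graph $\mathsf S$ with an etale morphism $\mathsf S\to\mathsf Y$; the Kleisli morphism is *generic* (a *refinement*) if $\mathsf S\to\mathsf Y$ is invertible. Generic morphisms form a wide subcategory $\widetilde{\mathbf{Gr}}_{\rm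 gen}\subset\widetilde{\mathbf{Gr}}$. **Statement.** There is a canonical equivalence of categories $$\Phi_2:\mathbf{BM}_{\rm comp}\;\simeq\;\widetilde{\mathbf{Gr}}{}_{\rm gen}^{\rm op}.$$ On objects it sends $(V,F,\partial,j)$ to the graph without isolated edges with vertex set $V$, $H=F$, $p=\partial$, $A=F+T$, $s$ the inclusion of $F$, and involution $i$ given by $j$ on the flags that are not tails and interchanging each tail with its copy in $T$. It sends a compression $h:\sigma\to\rho$ to a generic morphism $\mathsf R\to\mathsf S$ between the graphs $\mathsf R,\mathsf S$ associated with $\rho,\sigma$, which sends the arc of each flag $f\in F_\rho$ to the arc of the flag $h^F(f)$, and for which the vertices of $\mathsf S$ in the image of the graph $\mathsf S_x\to\mathsf S$ assigned to a vertex $x$ of $\mathsf R$ are exactly those in $h_V^{-1}(x)$. -/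

import Mathlib

open CategoryTheory

noncomputable section

/-- A graph in the sense of Joyal and Kock: finite sets `A` of arcs, `H` of half-edges (flags),
`V` of vertices, a fixpoint-free involution `i` on `A`, an injection `s : H → A` and a map
`p : H → V`. -/
structure Gr where
  A : Type
  H : Type
  V : Type
  finA : Finite A
  finH : Finite H
  finV : Finite V
  i : A → A
  s : H → A
  p : H → V
  i_i : ∀ a, i (i a) = a
  i_ne : ∀ a, i a ≠ a
  s_inj : Function.Injective s

namespace Gr

/-- An etale morphism of graphs: the square of `p`'s is a pullback. -/
@[ext]
structure Hom (X Y : Gr) where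
  a : X.A → Y.A
  h : X.H → Y.H
  v : X.V → Y.V
  a_i : ∀ x, a (X.i x) = Y.i (a x)
  a_s : ∀ x, a (X.s x) = Y.s (h x)
  v_p : ∀ x, v (X.p x) = Y.p (h x)
  cart : ∀ (w : X.V) (k : Y.H), Y.p k = v w → ∃! x : X.H, X.p x = w ∧ h x = k

instance : Category Gr where
  Hom := Hom
  id X :=
    { a := id, h := id, v := id, a_i := fun _ => rfl, a_s := fun _ => rfl, v_p := fun _ => rfl
      cart := fun w k hk => ⟨k, ⟨hk, rfl⟩, fun _ hy => hy.2⟩ }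
  comp {X Y Z} f g :=
    { a := g.a ∘ f.a, h := g.h ∘ f.h, v := g.v ∘ f.v
      a_i := fun x => by simp [f.a_i, g.a_i]
      a_s := fun x => by simp [f.a_s, g.a_s]
      v_p := fun x => by simp [f.v_p, g.v_p]
      cart := fun w k hk => by
        obtain ⟨y, ⟨hy1, hy2⟩, hy3⟩ := g.cart (f.v w) k hk
        obtain ⟨x, ⟨hx1, hx2⟩, hx3⟩ := f.cart w y hy1
        refine ⟨x, ⟨hx1, by simp [hx2, hy2]⟩, fun x' hx' => hx3 x' ⟨hx'.1, hy3 _ ⟨?_, hx'.2⟩⟩⟩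
        rw [← f.v_p, hx'.1] }

@[simp] lemma id_a (X : Gr) (x : X.A) : Hom.a (𝟙 X) x = x := rfl
@[simp] lemma id_h (X : Gr) (x : X.H) : Hom.h (𝟙 X) x = x := rfl
@[simp] lemma id_v (X : Gr) (x : X.V) : Hom.v (𝟙 X) x = x := rfl
@[simp] lemma comp_a {X Y Z : Gr} (f : X ⟶ Y) (g : Y ⟶ Z) (x : X.A) :
    (f ≫ g).a x = g.a (f.a x) := rfl
@[simp] lemma comp_h {X Y Z : Gr} (f : X ⟶ Y) (g : Y ⟶ Z) (x : X.H) :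
    (f ≫ g).h x = g.h (f.h x) := rfl
@[simp] lemma comp_v {X Y Z : Gr} (f : X ⟶ Y) (g : Y ⟶ Z) (x : X.V) :
    (f ≫ g).v x = g.v (f.v x) := rfl

lemma hom_ext {X Y : Gr} {f g : X ⟶ Y} (ha : ∀ x, f.a x = g.a x) (hh : ∀ x, f.h x = g.h x)
    (hv : ∀ x, f.v x = g.v x) : f = g :=
  Hom.ext (funext ha) (funext hh) (funext hv)

/-- A port is an arc which is not in the image of `s`. -/
def IsPort (X : Gr) (a : X.A) : Prop := a ∉ Set.range X.s

/-- An edge `{a, i a}` is isolated if both of its arcs are ports. -/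
def NoIsolatedEdges (X : Gr) : Prop := ∀ a, ¬ (X.IsPort a ∧ X.IsPort (X.i a))

/-- A graph is effective if it is nonempty and has no isolated edges. -/
def Effective (X : Gr) : Prop := (Nonempty X.A ∨ Nonempty X.V) ∧ X.NoIsolatedEdges

/-- The unit graph: one edge, no vertices. -/
abbrev unit : Gr where
  A := Bool
  H := Empty
  V := Empty
  finA := inferInstance
  finH := inferInstance
  finV := inferInstance
  i := not
  s := Empty.elim
  p := Empty.elim
  i_i := by simp
  i_ne := by simp
  s_inj := fun x => x.elim

/-- The corolla with set of ports `n`. -/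
abbrev corolla (n : Type) (hn : Finite n) : Gr where
  A := n ⊕ n
  H := n
  V := Unit
  finA := inferInstance
  finH := hn
  finV := inferInstance
  i := Sum.swap
  s := Sum.inr
  p := fun _ => ()
  i_i := by simp
  i_ne := by rintro (a | a) <;> simp
  s_inj := Sum.inr_injective

end Gr

/-- The elementary graphs, that is, up to isomorphism, the connected graphs without inner edges:
the unit graph and the corollas, one for each finite set of ports. -/
inductive El : Type 1
  | unit : El
  | cor (n : Type) (hn : Finite n) : El

/-- The elementary graphs as graphs. -/
abbrev El.gr : El → Gr
  | .unit => Gr.unit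
  | .cor n hn => Gr.corolla n hn

/-- The category of elementary graphs is the full subcategory of the category of graphs and
etale morphisms. -/
instance : Category El where
  Hom E E' := E.gr ⟶ E'.gr
  id E := 𝟙 E.gr
  comp {E E' E''} f g := (show E.gr ⟶ E''.gr from
    (show E.gr ⟶ E'.gr from f) ≫ (show E'.gr ⟶ E''.gr from g))
  id_comp {E E'} f := Category.id_comp (show E.gr ⟶ E'.gr from f)
  comp_id {E E'} f := Category.comp_id (show E.gr ⟶ E'.gr from f)
  assoc {E E' E'' E'''} f g h := Category.assoc (show E.gr ⟶ E'.gr from f)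
    (show E'.gr ⟶ E''.gr from g) (show E''.gr ⟶ E'''.gr from h)

/-- Graphical species: presheaves on the category of elementary graphs. The values are in `Type 1`,
so that sets of isomorphism classes of (small) decorated graphs are allowed as values. -/
abbrev Species := Elᵒᵖ ⥤ Type 1

/-- Restriction of elements of a species along a morphism of elementary graphs. -/
abbrev Species.res (F : Species) {E E' : El} (u : E' ⟶ E) (x : F.obj (.op E)) : F.obj (.op E') :=
  F.map u.op x

/-- The embedding of graphs into graphical species, `X ↦ Hom(-, X)`. -/
def yo : Gr ⥤ Species where
  obj X :=
    { obj := fun E => ULift (E.unop.gr ⟶ X)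
      map := fun u => TypeCat.ofHom fun x => ⟨Quiver.Hom.unop u ≫ x.down⟩ }
  map f := { app := fun E => TypeCat.ofHom fun x => ⟨x.down ≫ f⟩ }

/-- A morphism of species `γ : X ⟶ F`, with `X` a graph, evaluated at an element `u` of `X`. -/
def ev {X : Gr} {F : Species} (γ : yo.obj X ⟶ F) {E : El} (u : E.gr ⟶ X) : F.obj (.op E) :=
  γ.app (.op E) ⟨u⟩

lemma res_id (F : Species) {E : El} (x : F.obj (.op E)) : F.res (𝟙 E) x = x := by
  simp [Species.res]

lemma res_res (F : Species) {E E' E'' : El} (u : E' ⟶ E) (w : E'' ⟶ E') (x : F.obj (.op E)) :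
    F.res w (F.res u x) = F.res (w ≫ u) x := by
  simp [Species.res]

lemma app_res {F G : Species} (θ : F ⟶ G) {E E' : El} (u : E' ⟶ E) (x : F.obj (.op E)) :
    θ.app _ (F.res u x) = G.res u (θ.app _ x) :=
  ConcreteCategory.congr_hom (θ.naturality u.op) x

lemma res_ev {X : Gr} {F : Species} (γ : yo.obj X ⟶ F) {E E' : El} (w : E' ⟶ E) (u : E.gr ⟶ X) :
    F.res w (ev γ u) = ev γ ((show E'.gr ⟶ E.gr from w) ≫ u) :=
  (app_res γ w ⟨u⟩).symm

lemma ev_comp {X : Gr} {F G : Species} (γ : yo.obj X ⟶ F) (θ : F ⟶ G) {E : El} (u : E.gr ⟶ X) :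
    ev (γ ≫ θ) u = θ.app _ (ev γ u) := rfl

lemma ev_yo {X Y : Gr} {F : Species} (f : X ⟶ Y) (γ : yo.obj Y ⟶ F) {E : El} (u : E.gr ⟶ X) :
    ev (yo.map f ≫ γ) u = ev γ (u ≫ f) := rfl

lemma ev_ext {X : Gr} {F : Species} {γ γ' : yo.obj X ⟶ F}
    (h : ∀ (E : El) (u : E.gr ⟶ X), ev γ u = ev γ' u) : γ = γ' := by
  ext E x
  exact h E.unop x.down

namespace Gr

/-- The morphism from the unit graph picking out an arc. -/
def arc (X : Gr) (a : X.A) : El.unit.gr ⟶ X where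
  a := fun b => Bool.rec (X.i a) a b
  h := fun x => Empty.elim x
  v := fun x => Empty.elim x
  a_i := by rintro (_ | _) <;> simp [El.gr, unit, X.i_i]
  a_s := fun x => Empty.elim x
  v_p := fun x => Empty.elim x
  cart := fun x => Empty.elim x

@[simp] lemma arc_true (X : Gr) (a : X.A) : (X.arc a).a true = a := rfl

lemma unit_hom_ext {X : Gr} {u u' : El.unit.gr ⟶ X} (h : u.a true = u'.a true) : u = u' := by
  refine hom_ext ?_ (fun x => Empty.elim x) (fun x => Empty.elim x)
  rintro (_ | _)
  · exact (u.a_i true).trans ((congrArg X.i h).trans (u'.a_i true).symm)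
  · exact h

lemma eq_arc {X : Gr} (u : El.unit.gr ⟶ X) : u = X.arc (u.a true) := unit_hom_ext rfl

lemma arc_comp {X Y : Gr} (a : X.A) (f : X ⟶ Y) : X.arc a ≫ f = Y.arc (f.a a) := unit_hom_ext rfl

/-- The reversal of the unit graph. -/
def rev : El.unit ⟶ El.unit := El.unit.gr.arc false

lemma rev_comp_arc (X : Gr) (a : X.A) :
    (show El.unit.gr ⟶ El.unit.gr from rev) ≫ X.arc a = X.arc (X.i a) := unit_hom_ext rfl

/-- The set of flags at a vertex. -/
abbrev Fl (X : Gr) (w : X.V) : Type := {h : X.H // X.p h = w}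

lemma finite_fl (X : Gr) (w : X.V) : Finite (X.Fl w) :=
  have := X.finH
  inferInstance

/-- The corolla at a vertex, with its flags as set of ports. -/
abbrev elAt (X : Gr) (w : X.V) : El := .cor (X.Fl w) (X.finite_fl w)

/-- The canonical morphism from the corolla at `w`. -/
def corAt (X : Gr) (w : X.V) : (X.elAt w).gr ⟶ X where
  a := Sum.elim (fun h => X.i (X.s h.1)) (fun h => X.s h.1)
  h := fun h => h.1
  v := fun _ => w
  a_i := by rintro (a | a) <;> simp [X.i_i]
  a_s := fun x => rfl
  v_p := fun x => x.2.symm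
  cart := fun _ k hk => ⟨⟨k, hk⟩, ⟨rfl, rfl⟩, fun y hy => Subtype.ext hy.2⟩

lemma cor_hom_ext {n : Type} {hn : Finite n} {X : Gr} {u u' : (El.cor n hn).gr ⟶ X}
    (hv : u.v () = u'.v ()) (h : ∀ x, u.h x = u'.h x) : u = u' := by
  refine hom_ext ?_ h (fun _ => hv)
  have key : ∀ x : n, u.a (Sum.inr x) = u'.a (Sum.inr x) := fun x =>
    (u.a_s x).trans ((congrArg X.s (h x)).trans (u'.a_s x).symm)
  rintro (x | x)
  · exact (u.a_i (Sum.inr x)).trans ((congrArg X.i (key x)).trans (u'.a_i (Sum.inr x)).symm)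
  · exact key x

section lift

variable {X Y : Gr} (f : X ⟶ Y) {n : Type} {hn : Finite n} (u : (El.cor n hn).gr ⟶ Y) (w : X.V)

lemma lift_aux (hw : f.v w = u.v ()) (x : n) : ∃! k : X.H, X.p k = w ∧ f.h k = u.h x :=
  f.cart w (u.h x) ((u.v_p x).symm.trans hw.symm)

variable (hw : f.v w = u.v ())

/-- Lifting a morphism from a corolla along an etale morphism, given a lift of the vertex. -/
def lift : (El.cor n hn).gr ⟶ X where
  a := Sum.elim (fun x => X.i (X.s (lift_aux f u w hw x).choose))
    (fun x => X.s (lift_aux f u w hw x).choose)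
  h := fun x => (lift_aux f u w hw x).choose
  v := fun _ => w
  a_i := by rintro (a | a) <;> simp [X.i_i]
  a_s := fun x => rfl
  v_p := fun x => (lift_aux f u w hw x).choose_spec.1.1.symm
  cart := fun _ k hk => by
    obtain ⟨x, ⟨_, hx⟩, hx'⟩ := u.cart () (f.h k) (by rw [← f.v_p, hk, hw])
    refine ⟨x, ⟨rfl, ?_⟩, fun y hy => hx' y ⟨rfl, ?_⟩⟩
    · exact ((lift_aux f u w hw x).choose_spec.2 k ⟨hk, hx.symm⟩).symm
    · exact ((lift_aux f u w hw y).choose_spec.1.2).symm.trans (congrArg f.h hy.2)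

lemma lift_comp : lift f u w hw ≫ f = u :=
  cor_hom_ext hw fun x => (lift_aux f u w hw x).choose_spec.1.2

@[simp] lemma lift_v (x) : (lift f u w hw).v x = w := rfl

lemma lift_unique (u' : (El.cor n hn).gr ⟶ X) (h1 : u' ≫ f = u) (h2 : u'.v () = w) :
    u' = lift f u w hw :=
  cor_hom_ext h2 fun x => (lift_aux f u w hw x).choose_spec.2 _
    ⟨(u'.v_p x).symm.trans h2, by rw [← h1]; rfl⟩

end lift

/-- Every morphism from a corolla factors through the corolla at the image vertex. -/
def fac {X : Gr} {n : Type} {hn : Finite n} (u : (El.cor n hn).gr ⟶ X) :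
    El.cor n hn ⟶ X.elAt (u.v ()) :=
  lift (X.corAt (u.v ())) u () rfl

lemma fac_comp {X : Gr} {n : Type} {hn : Finite n} (u : (El.cor n hn).gr ⟶ X) :
    (show (El.cor n hn).gr ⟶ (X.elAt (u.v ())).gr from fac u) ≫ X.corAt (u.v ()) = u :=
  lift_comp _ _ _ _

lemma fac_unique {X : Gr} {n : Type} {hn : Finite n} (u : (El.cor n hn).gr ⟶ X)
    (r : (El.cor n hn).gr ⟶ (X.elAt (u.v ())).gr) (hr : r ≫ X.corAt (u.v ()) = u) : r = fac u :=
  lift_unique _ _ _ _ _ hr rfl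

/-- The morphism of elementary graphs picking out the outgoing arc of a flag of a corolla. -/
def out {n : Type} {hn : Finite n} (x : n) : El.unit ⟶ El.cor n hn :=
  (El.cor n hn).gr.arc (Sum.inr x)

lemma out_comp {X : Gr} {n : Type} {hn : Finite n} (u : (El.cor n hn).gr ⟶ X) (x : n) :
    (show El.unit.gr ⟶ (El.cor n hn).gr from out x) ≫ u = X.arc (X.s (u.h x)) :=
  unit_hom_ext (u.a_s x)

lemma rev_out {n : Type} {hn : Finite n} (x : n) :
    rev ≫ out (hn := hn) x = (El.cor n hn).gr.arc (Sum.inl x) :=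
  unit_hom_ext rfl

end Gr

open Gr

lemma dec_ext {X : Gr} {F : Species} {γ γ' : yo.obj X ⟶ F}
    (ha : ∀ a, ev γ (X.arc a) = ev γ' (X.arc a)) (hc : ∀ w, ev γ (X.corAt w) = ev γ' (X.corAt w)) :
    γ = γ' := by
  refine ev_ext fun E u => ?_
  cases E with
  | unit => rw [eq_arc u, ha]
  | cor n hn => rw [← fac_comp u, ← res_ev, ← res_ev, hc]

lemma ev_arc_i {X : Gr} {F : Species} (γ : yo.obj X ⟶ F) (a : X.A) :
    ev γ (X.arc (X.i a)) = F.res rev (ev γ (X.arc a)) := by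
  rw [res_ev, rev_comp_arc]

lemma ev_arc_s {X : Gr} {F : Species} (γ : yo.obj X ⟶ F) {w : X.V} (h : X.Fl w) :
    ev γ (X.arc (X.s h.1)) = F.res (out h) (ev γ (X.corAt w)) := by
  rw [res_ev]
  exact congrArg _ (unit_hom_ext rfl)

/-- The data of a morphism of species out of a graph. -/
structure DecData (X : Gr) (F : Species) where
  d : X.A → F.obj (.op .unit)
  c : ∀ w, F.obj (.op (X.elAt w))
  d_i : ∀ a, d (X.i a) = F.res rev (d a)
  d_s : ∀ w (h : X.Fl w), d (X.s h.1) = F.res (out h) (c w)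

/-- The value of a morphism of species built from `DecData`. -/
def DecData.val {X : Gr} {F : Species} (D : DecData X F) :
    ∀ (E : El), (E.gr ⟶ X) → F.obj (.op E)
  | .unit, u => D.d (u.a true)
  | .cor _ _, u => F.res (fac u) (D.c (u.v ()))

lemma DecData.val_nat {X : Gr} {F : Species} (D : DecData X F) {E E' : El} (w : E' ⟶ E)
    (u : E.gr ⟶ X) :
    D.val E' ((show E'.gr ⟶ E.gr from w) ≫ u) = F.res w (D.val E u) := by
  match E, E', w, u with
  | .unit, .cor _ _, w, u => exact Empty.elim (Gr.Hom.v w ())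
  | .unit, .unit, w, u =>
    have hw : w = El.unit.gr.arc (Gr.Hom.a w true) := eq_arc w
    cases hb : Gr.Hom.a w true with
    | true =>
      have : w = 𝟙 El.unit := unit_hom_ext hb
      subst this
      rw [res_id]; rfl
    | false =>
      have : w = rev := unit_hom_ext hb
      subst this
      exact (congrArg D.d (u.a_i true)).trans (D.d_i _)
  | .cor n hn, .cor m hm, w, u =>
    change F.res (fac _) (D.c _) = F.res w (F.res (fac u) (D.c _))
    rw [res_res]
    congr 2
    symm
    refine fac_unique ((show (El.cor m hm).gr ⟶ (El.cor n hn).gr from w) ≫ u) _ ?_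
    exact congrArg (fun t => (show (El.cor m hm).gr ⟶ (El.cor n hn).gr from w) ≫ t) (fac_comp u)
  | .cor n hn, .unit, w, u =>
    change D.d (u.a (Gr.Hom.a w true)) = F.res w (F.res (fac u) (D.c _))
    rw [res_res]
    have hs : ∀ x : n, D.d (u.a (Sum.inr x)) = F.res (out x ≫ fac u) (D.c (u.v ())) := by
      intro x
      have h1 : out x ≫ fac u = out (Gr.Hom.h (fac u) x) := out_comp _ _
      rw [h1]
      refine Eq.trans ?_ (D.d_s _ (Gr.Hom.h (fac u) x))
      congr 1
      refine (u.a_s x).trans (congrArg X.s ?_)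
      exact (congrArg (fun t => Gr.Hom.h t x) (fac_comp u)).symm
    have hw : w = (El.cor n hn).gr.arc (Gr.Hom.a w true) := eq_arc w
    generalize Gr.Hom.a w true = b at hw ⊢
    subst hw
    cases b with
    | inr x => exact hs x
    | inl x =>
      rw [← rev_out, Category.assoc, ← res_res, ← hs, ← D.d_i]
      exact congrArg D.d (u.a_i (Sum.inr x))

/-- The morphism of species built from `DecData`. -/
def DecData.hom {X : Gr} {F : Species} (D : DecData X F) : yo.obj X ⟶ F where
  app E := TypeCat.ofHom fun u => D.val E.unop u.down
  naturality E E' w := by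
    ext u
    exact D.val_nat w.unop u.down

lemma DecData.hom_arc {X : Gr} {F : Species} (D : DecData X F) (a : X.A) :
    ev D.hom (X.arc a) = D.d a := rfl

lemma DecData.hom_cor {X : Gr} {F : Species} (D : DecData X F) (w : X.V) :
    ev D.hom (X.corAt w) = D.c w := by
  have : fac (X.corAt w) = 𝟙 (X.elAt w) :=
    (fac_unique (X.corAt w) (𝟙 _) (Category.id_comp _)).symm
  change F.res (fac (X.corAt w)) (D.c w) = _
  rw [this]
  exact res_id F (D.c w)

/-- The etale morphism underlying a morphism of species between graphs. -/
def unyo {X Y : Gr} (θ : yo.obj X ⟶ yo.obj Y) : X ⟶ Y :=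
  have hk : ∀ (w : X.V) (k : X.Fl w), (ev θ (X.corAt (X.p k.1))).down.h ⟨k.1, rfl⟩ =
      (ev θ (X.corAt w)).down.h k := by rintro _ ⟨k, rfl⟩; rfl
  { a := fun a => (ev θ (X.arc a)).down.a true
    h := fun k => (ev θ (X.corAt (X.p k))).down.h ⟨k, rfl⟩
    v := fun w => (ev θ (X.corAt w)).down.v ()
    a_i := fun a => by
      rw [ev_arc_i]
      exact (ev θ (X.arc a)).down.a_i true
    a_s := fun k => by
      rw [ev_arc_s θ (⟨k, rfl⟩ : X.Fl (X.p k))]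
      exact (ev θ (X.corAt (X.p k))).down.a_s ⟨k, rfl⟩
    v_p := fun k => (ev θ (X.corAt (X.p k))).down.v_p ⟨k, rfl⟩
    cart := fun w k hkw => by
      obtain ⟨x, ⟨_, hx⟩, hx'⟩ := (ev θ (X.corAt w)).down.cart () k hkw
      refine ⟨x.1, ⟨x.2, (hk w x).trans hx⟩, fun y hy => ?_⟩
      let y' : X.Fl w := ⟨y, hy.1⟩
      have hy' : y' = x := hx' y' ⟨rfl, (hk w y').symm.trans hy.2⟩
      exact congrArg Subtype.val hy' }

lemma yo_unyo {X Y : Gr} (θ : yo.obj X ⟶ yo.obj Y) : yo.map (unyo θ) = θ := by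
  refine dec_ext (fun a => ?_) (fun w => ?_)
  · exact congrArg ULift.up (unit_hom_ext rfl)
  · refine congrArg ULift.up (cor_hom_ext rfl ?_)
    rintro ⟨k, rfl⟩
    rfl

lemma yo_injective {X Y : Gr} {f g : X ⟶ Y} (h : yo.map f = yo.map g) : f = g := by
  have ha : ∀ a, X.arc a ≫ f = X.arc a ≫ g := fun a =>
    congrArg ULift.down (congrArg (fun t => ev t (X.arc a)) h)
  have hc : ∀ w, X.corAt w ≫ f = X.corAt w ≫ g := fun w =>
    congrArg ULift.down (congrArg (fun t => ev t (X.corAt w)) h)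
  refine Gr.hom_ext (fun a => ?_) (fun k => ?_) (fun w => ?_)
  · exact congrArg (fun t => Gr.Hom.a t true) (ha a)
  · exact congrArg (fun t : (X.elAt (X.p k)).gr ⟶ Y => t.h ⟨k, rfl⟩) (hc (X.p k))
  · exact congrArg (fun t => Gr.Hom.v t ()) (hc w)

/-- For a finite set `n`, an effective `n`-graph is an effective graph with a bijection between
`n` and its set of ports. -/
structure NGraph (n : Type) where
  G : Gr
  eff : G.Effective
  β : n ≃ {a : G.A // G.IsPort a}

/-- The port with label `x`. -/
def NGraph.port {n : Type} (X : NGraph n) (x : n) : X.G.A := (X.β x).1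

/-- An effective `n`-graph decorated by a species `F`: an `n`-graph `G` with an element of
`F[G]`, that is, a morphism of species `G ⟶ F`. -/
structure DGraph (n : Type) (F : Species) extends NGraph n where
  γ : yo.obj G ⟶ F

/-- Let `G` be a graph, and for each vertex `v` let `K v` be a graph with some arcs `b v`
indexed by the flags at `v`. A cocone with vertex `F` consists of morphisms `K v ⟶ F` and an
involutive map from the arcs of `G` to `F`, sending the arc pointing towards `v` at a flag `h`
to the value at `b v h`. -/
structure Coc (G : Gr) (K : G.V → Gr) (b : ∀ v, G.Fl v → (K v).A) (F : Species) where
  γ : ∀ v, yo.obj (K v) ⟶ F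
  d : G.A → F.obj (.op .unit)
  d_i : ∀ x, d (G.i x) = F.res rev (d x)
  compat : ∀ v (h : G.Fl v), ev (γ v) ((K v).arc (b v h)) = d (G.i (G.s h.1))

/-- Composing a cocone with a morphism. -/
def Coc.push {G : Gr} {K : G.V → Gr} {b : ∀ v, G.Fl v → (K v).A} {F F' : Species}
    (c : Coc G K b F) (θ : F ⟶ F') : Coc G K b F' where
  γ v := c.γ v ≫ θ
  d x := θ.app _ (c.d x)
  d_i x := by rw [c.d_i, app_res]
  compat v h := by rw [ev_comp, c.compat]

/-- A cocone is a colimit cocone. -/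
def Coc.IsUniv {G : Gr} {K : G.V → Gr} {b : ∀ v, G.Fl v → (K v).A} {S : Species}
    (c : Coc G K b S) : Prop :=
  ∀ (F : Species) (c' : Coc G K b F), ∃! k : S ⟶ F,
    (∀ v, c.γ v ≫ k = c'.γ v) ∧ ∀ x, k.app _ (c.d x) = c'.d x

section glue

variable (G : Gr) (K : ∀ v, NGraph (G.Fl v))

/-- The arcs of a graph whose edge is an inner edge. -/
abbrev Gr.Inner (X : Gr) : Type := {a : X.A // ¬ X.IsPort a ∧ ¬ X.IsPort (X.i a)}

open Classical in
/-- The map from the arcs of the graph substituted for `v` to the arcs of the glued graph. Arcs of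
the glued graph are the arcs of `G` and the arcs of the inner edges of the graphs `K v`. -/
def glueA (v : G.V) (a : (K v).G.A) : G.A ⊕ (Σ v, (K v).G.Inner) :=
  if h : (K v).G.IsPort a then .inl (G.i (G.s ((K v).β.symm ⟨a, h⟩).1))
  else if h' : (K v).G.IsPort ((K v).G.i a) then .inl (G.s ((K v).β.symm ⟨_, h'⟩).1)
  else .inr ⟨v, a, h, h'⟩

variable {G K}

lemma NGraph.not_port_i {n : Type} (X : NGraph n) (x : n) : ¬ X.G.IsPort (X.G.i (X.port x)) :=
  fun h => X.eff.2 _ ⟨(X.β x).2, h⟩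

lemma glueA_port (v : G.V) (h : G.Fl v) : glueA G K v ((K v).port h) = .inl (G.i (G.s h.1)) := by
  have : (K v).G.IsPort ((K v).port h) := ((K v).β h).2
  rw [glueA, dif_pos this]
  simp [NGraph.port]

lemma glueA_i_port (v : G.V) (h : G.Fl v) :
    glueA G K v ((K v).G.i ((K v).port h)) = .inl (G.s h.1) := by
  have : (K v).G.IsPort ((K v).G.i ((K v).G.i ((K v).port h))) := by
    rw [Gr.i_i]; exact ((K v).β h).2
  rw [glueA, dif_neg ((K v).not_port_i h), dif_pos this]
  have : (K v).β.symm ⟨_, this⟩ = h := by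
    rw [Equiv.symm_apply_eq]
    exact Subtype.ext ((K v).G.i_i _)
  rw [this]

lemma glueA_inner (v : G.V) (a : (K v).G.Inner) : glueA G K v a.1 = .inr ⟨v, a⟩ := by
  rw [glueA, dif_neg a.2.1, dif_neg a.2.2]

lemma NGraph.arc_cases {n : Type} (X : NGraph n) (a : X.G.A) :
    (∃ x, a = X.port x) ∨ (∃ x, a = X.G.i (X.port x)) ∨ ∃ y : X.G.Inner, a = y.1 := by
  by_cases h : X.G.IsPort a
  · exact .inl ⟨X.β.symm ⟨a, h⟩, by simp [NGraph.port]⟩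
  by_cases h' : X.G.IsPort (X.G.i a)
  · exact .inr (.inl ⟨X.β.symm ⟨_, h'⟩, by simp [NGraph.port, Gr.i_i]⟩)
  · exact .inr (.inr ⟨⟨a, h, h'⟩, rfl⟩)

lemma Gr.not_port_s (X : Gr) (h : X.H) : ¬ X.IsPort (X.s h) := fun h' => h' ⟨h, rfl⟩

variable (G K)

/-- The involution on the arcs of the glued graph. -/
def glueI : G.A ⊕ (Σ v, (K v).G.Inner) → G.A ⊕ (Σ v, (K v).G.Inner)
  | .inl x => .inl (G.i x)
  | .inr ⟨v, a⟩ => .inr ⟨v, (K v).G.i a.1, a.2.2, by rw [Gr.i_i]; exact a.2.1⟩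

lemma glueA_i (v : G.V) (a : (K v).G.A) :
    glueA G K v ((K v).G.i a) = glueI G K (glueA G K v a) := by
  obtain ⟨x, rfl⟩ | ⟨x, rfl⟩ | ⟨y, rfl⟩ := (K v).arc_cases a
  · rw [glueA_port, glueA_i_port, glueI, Gr.i_i]
  · rw [Gr.i_i, glueA_port, glueA_i_port, glueI]
  · rw [glueA_inner v y, glueI]
    exact glueA_inner v ⟨_, _⟩

lemma glueA_s_inj (v v' : G.V) (h : (K v).G.H) (h' : (K v').G.H)
    (e : glueA G K v ((K v).G.s h) = glueA G K v' ((K v').G.s h')) :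
    (⟨v, h⟩ : Σ v, (K v).G.H) = ⟨v', h'⟩ := by
  obtain ⟨x, hx⟩ | ⟨x, hx⟩ | ⟨y, hy⟩ := (K v).arc_cases ((K v).G.s h)
  · exact ((K v).G.not_port_s h (hx ▸ ((K v).β x).2)).elim
  · obtain ⟨x', hx'⟩ | ⟨x', hx'⟩ | ⟨y', hy'⟩ := (K v').arc_cases ((K v').G.s h')
    · exact ((K v').G.not_port_s h' (hx' ▸ ((K v').β x').2)).elim
    · rw [hx, hx', glueA_i_port, glueA_i_port, Sum.inl.injEq] at e
      have e' := G.s_inj e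
      obtain ⟨x, rfl⟩ := x
      obtain ⟨x', rfl⟩ := x'
      cases e'
      rw [← hx'] at hx
      cases (K _).G.s_inj hx
      rfl
    · rw [hx, hy', glueA_i_port, glueA_inner] at e
      cases e
  · obtain ⟨x', hx'⟩ | ⟨x', hx'⟩ | ⟨y', hy'⟩ := (K v').arc_cases ((K v').G.s h')
    · exact ((K v').G.not_port_s h' (hx' ▸ ((K v').β x').2)).elim
    · rw [hx', hy, glueA_i_port, glueA_inner] at e
      cases e
    · rw [hy, hy', glueA_inner, glueA_inner, Sum.inr.injEq] at e
      cases e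
      rw [← hy'] at hy
      cases (K _).G.s_inj hy
      rfl

/-- The graph obtained by gluing the graphs `K v` according to the same recipe by which `G` is
glued from its corollas: the port of `K v` labelled by a flag `h` at `v` is identified with the arc
of `G` at `h` pointing towards `v`. -/
def glue : Gr where
  A := G.A ⊕ (Σ v, (K v).G.Inner)
  H := Σ v, (K v).G.H
  V := Σ v, (K v).G.V
  finA := by
    have := G.finA; have := G.finV; have := fun v => (K v).G.finA
    infer_instance
  finH := by
    have := G.finV; have := fun v => (K v).G.finH
    infer_instance
  finV := by
    have := G.finV; have := fun v => (K v).G.finV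
    infer_instance
  i := glueI G K
  s := fun h => glueA G K h.1 ((K h.1).G.s h.2)
  p := fun h => ⟨h.1, (K h.1).G.p h.2⟩
  i_i := by
    rintro (x | ⟨v, a⟩)
    · simp [glueI, Gr.i_i]
    · simp [glueI, Gr.i_i]
  i_ne := by
    rintro (x | ⟨v, a⟩) h
    · exact G.i_ne x (Sum.inl.inj h)
    · simp only [glueI, Sum.inr.injEq, Sigma.mk.injEq, heq_eq_eq, true_and] at h
      exact (K v).G.i_ne a.1 (congrArg Subtype.val h)
  s_inj := fun h h' e => glueA_s_inj G K h.1 h'.1 h.2 h'.2 e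

/-- The etale morphism from `K v` to the glued graph. -/
def glueQ (v : G.V) : (K v).G ⟶ glue G K where
  a := glueA G K v
  h := fun h => ⟨v, h⟩
  v := fun w => ⟨v, w⟩
  a_i := glueA_i G K v
  a_s := fun _ => rfl
  v_p := fun _ => rfl
  cart := by
    rintro w ⟨v', h⟩ hh
    cases hh
    exact ⟨h, ⟨rfl, rfl⟩, fun y hy => by cases hy.2; rfl⟩

lemma glue_isPort_inl (x : G.A) : (glue G K).IsPort (.inl x) ↔ G.IsPort x := by
  rw [← not_iff_not]
  simp only [Gr.IsPort, not_not, Set.mem_range]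
  constructor
  · rintro ⟨⟨v, h⟩, hh⟩
    change glueA G K v _ = _ at hh
    obtain ⟨x, hx⟩ | ⟨x, hx⟩ | ⟨y, hy⟩ := (K v).arc_cases ((K v).G.s h)
    · exact ((K v).G.not_port_s h (hx ▸ ((K v).β x).2)).elim
    · rw [hx, glueA_i_port] at hh
      exact ⟨_, Sum.inl.inj hh⟩
    · rw [hy, glueA_inner] at hh
      cases hh
  · rintro ⟨h, rfl⟩
    have := (K (G.p h)).not_port_i ⟨h, rfl⟩
    rw [Gr.IsPort, not_not] at this
    obtain ⟨h', hh'⟩ := this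
    refine ⟨⟨G.p h, h'⟩, ?_⟩
    change glueA G K _ _ = _
    rw [hh', glueA_i_port]

lemma glue_isPort_inr (x) : ¬ (glue G K).IsPort (.inr x) := by
  obtain ⟨v, y⟩ := x
  obtain ⟨h, hh⟩ := not_not.1 y.2.1
  refine not_not.2 ⟨⟨v, h⟩, ?_⟩
  change glueA G K v _ = _
  rw [hh, glueA_inner]

lemma glue_noIsolatedEdges (hG : G.NoIsolatedEdges) : (glue G K).NoIsolatedEdges := by
  rintro (x | x) ⟨h1, h2⟩
  · rw [glue_isPort_inl] at h1
    change (glue G K).IsPort (.inl (G.i x)) at h2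
    rw [glue_isPort_inl] at h2
    exact hG x ⟨h1, h2⟩
  · exact glue_isPort_inr G K x h1

lemma glue_effective (hG : G.Effective) : (glue G K).Effective := by
  refine ⟨?_, glue_noIsolatedEdges G K hG.2⟩
  obtain ⟨⟨⟨x⟩⟩ | ⟨⟨v⟩⟩, _⟩ := hG
  · exact .inl ⟨.inl x⟩
  · obtain ⟨⟨⟨x⟩⟩ | ⟨⟨w⟩⟩, _⟩ := (K v).eff
    · exact .inl ⟨glueA G K v x⟩
    · exact .inr ⟨⟨v, w⟩⟩

/-- The glued graph has the same ports as `G`. -/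
def gluePorts : {a : G.A // G.IsPort a} ≃ {a // (glue G K).IsPort a} :=
  Equiv.ofBijective (fun a => ⟨.inl a.1, (glue_isPort_inl G K a.1).2 a.2⟩) <| by
    constructor
    · intro a b h
      exact Subtype.ext (Sum.inl.inj (congrArg Subtype.val h))
    · rintro ⟨x | x, h⟩
      · exact ⟨⟨x, (glue_isPort_inl G K x).1 h⟩, rfl⟩
      · exact (glue_isPort_inr G K x h).elim

/-- The canonical cocone on the glued graph. -/
def glueCoc : Coc G (fun v => (K v).G) (fun v => (K v).port) (yo.obj (glue G K)) where
  γ v := yo.map (glueQ G K v)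
  d x := ⟨(glue G K).arc (.inl x)⟩
  d_i _ := congrArg ULift.up (unit_hom_ext rfl)
  compat v h := congrArg ULift.up (unit_hom_ext (glueA_port v h))

lemma glueCoc_isUniv : (glueCoc G K).IsUniv := by
  intro F c'
  let d : (glue G K).A → F.obj (.op .unit) :=
    Sum.elim c'.d fun y => ev (c'.γ y.1) ((K y.1).G.arc y.2.1)
  have hd : ∀ v (a : (K v).G.A), d (glueA G K v a) = ev (c'.γ v) ((K v).G.arc a) := by
    intro v a
    obtain ⟨x, rfl⟩ | ⟨x, rfl⟩ | ⟨y, rfl⟩ := (K v).arc_cases a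
    · rw [glueA_port, c'.compat]; rfl
    · rw [glueA_i_port, ev_arc_i, c'.compat, ← c'.d_i, Gr.i_i]; rfl
    · rw [glueA_inner]; rfl
  let L : ∀ w : (glue G K).V, ((glue G K).elAt w).gr ⟶ (K w.1).G := fun w =>
    lift (glueQ G K w.1) ((glue G K).corAt w) w.2 rfl
  have hL : ∀ w, L w ≫ glueQ G K w.1 = (glue G K).corAt w := fun w => lift_comp _ _ _ _
  let D : DecData (glue G K) F :=
    { d := d
      c := fun w => ev (c'.γ w.1) (L w)
      d_i := by
        rintro (x | ⟨v, y⟩)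
        · exact c'.d_i x
        · exact ev_arc_i (c'.γ v) y.1
      d_s := fun w h => by
        rw [res_ev]
        refine Eq.trans ?_ (congrArg (ev (c'.γ w.1)) (out_comp (L w) h).symm)
        rw [← hd]
        refine congrArg d ?_
        have : h.1 = (glueQ G K w.1).h ((L w).h h) :=
          (congrArg (fun t : ((glue G K).elAt w).gr ⟶ glue G K => t.h h) (hL w)).symm
        rw [this]
        exact ((glueQ G K w.1).a_s _).symm }
  refine ⟨D.hom, ⟨fun v => ?_, fun _ => rfl⟩, ?_⟩
  · refine dec_ext (fun a => ?_) (fun w => ?_)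
    · change ev D.hom ((K v).G.arc a ≫ glueQ G K v) = _
      rw [arc_comp, D.hom_arc]
      exact hd v a
    · change ev D.hom ((K v).G.corAt w ≫ glueQ G K v) = _
      let u := (K v).G.corAt w ≫ glueQ G K v
      change F.res (fac u) (ev (c'.γ v) (L ⟨v, w⟩)) = _
      refine (res_ev (c'.γ v) (fac u) (L ⟨v, w⟩)).trans ?_
      refine congrArg (ev (c'.γ v)) ?_
      let r : ((K v).G.elAt w).gr ⟶ ((glue G K).elAt ⟨v, w⟩).gr := fac u
      have h1 : (r ≫ L ⟨v, w⟩) ≫ glueQ G K v = u := by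
        rw [Category.assoc, hL ⟨v, w⟩]
        exact fac_comp u
      exact (lift_unique (glueQ G K v) u w rfl _ h1 rfl).trans
        (lift_unique (glueQ G K v) u w rfl ((K v).G.corAt w) rfl rfl).symm
  · rintro k ⟨hk1, hk2⟩
    refine dec_ext ?_ (fun w => ?_)
    · rintro (x | ⟨v, y⟩)
      · exact hk2 x
      · have : (glue G K).arc (.inr ⟨v, y⟩) = (K v).G.arc y.1 ≫ glueQ G K v :=
          unit_hom_ext (glueA_inner v y).symm
        refine (congrArg (ev k) this).trans ?_
        exact congrArg (fun t => ev t ((K v).G.arc y.1)) (hk1 v)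
    · rw [D.hom_cor, ← hL w, ← ev_yo]
      exact congrArg (fun t => ev t (L w)) (hk1 w.1)

end glue

/-- The colimit of the cocone shape, as a morphism out of the glued graph. -/
def glueDesc {G : Gr} {K : ∀ v, NGraph (G.Fl v)} {F : Species}
    (c : Coc G (fun v => (K v).G) (fun v => (K v).port) F) : yo.obj (glue G K) ⟶ F :=
  (glueCoc_isUniv G K F c).choose

section
variable {G : Gr} {K : ∀ v, NGraph (G.Fl v)} {F : Species}
    (c : Coc G (fun v => (K v).G) (fun v => (K v).port) F)

lemma glueDesc_q (v : G.V) : yo.map (glueQ G K v) ≫ glueDesc c = c.γ v :=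
  (glueCoc_isUniv G K F c).choose_spec.1.1 v

lemma glueDesc_d (x : G.A) : ev (glueDesc c) ((glue G K).arc (.inl x)) = c.d x :=
  (glueCoc_isUniv G K F c).choose_spec.1.2 x

end

/-! The monad. -/

namespace DGraph

variable {n m : Type} {F F' : Species}

/-- Isomorphism of decorated `n`-graphs: an isomorphism of graphs leaving the ports fixed and
compatible with the decorations. -/
def Rel (X Y : DGraph n F) : Prop :=
  ∃ e : X.G ≅ Y.G, (∀ x, e.hom.a (X.port x) = Y.port x) ∧ yo.map e.hom ≫ Y.γ = X.γ

/-- Isomorphism of decorated `n`-graphs, as an equivalence relation. -/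
def setoid (n : Type) (F : Species) : Setoid (DGraph n F) where
  r := Rel
  iseqv :=
    { refl := fun X => ⟨Iso.refl _, fun _ => rfl, by simp⟩
      symm := by
        rintro X Y ⟨e, h1, h2⟩
        refine ⟨e.symm, fun x => ?_, ?_⟩
        · rw [← h1, ← comp_a]; simp
        · rw [← h2, ← Category.assoc, ← Functor.map_comp]; simp
      trans := by
        rintro X Y Z ⟨e, h1, h2⟩ ⟨e', h1', h2'⟩
        refine ⟨e ≪≫ e', fun x => ?_, ?_⟩
        · rw [← h1', ← h1]; rfl
        · rw [← h2, ← h2']; simp }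

/-- The set of isomorphism classes of decorated `n`-graphs. -/
abbrev Cls (n : Type) (F : Species) : Type 1 := Quotient (setoid n F)

/-- The isomorphism class of a decorated `n`-graph. -/
abbrev cls (X : DGraph n F) : Cls n F := Quotient.mk (setoid n F) X

lemma cls_eq {X Y : DGraph n F} : X.cls = Y.cls ↔ Rel X Y :=
  ⟨fun h => Quotient.exact h, fun h => Quotient.sound h⟩

end DGraph

/-- Relabelling the ports. -/
def NGraph.relabel {n m : Type} (e : m ≃ n) (X : NGraph n) : NGraph m where
  G := X.G
  eff := X.eff
  β := e.trans X.β

/-- All arcs of the corolla `n` give arcs of an `n`-graph. -/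
def NGraph.arcOf {n : Type} (X : NGraph n) : n ⊕ n → X.G.A :=
  Sum.elim X.port (fun x => X.G.i (X.port x))

lemma NGraph.arcOf_swap {n : Type} (X : NGraph n) (x : n ⊕ n) :
    X.arcOf x.swap = X.G.i (X.arcOf x) := by
  cases x <;> simp [arcOf, Gr.i_i]

namespace DGraph

variable {n m : Type} {F F' : Species}

/-- Relabelling the ports. -/
def relabel (e : m ≃ n) (X : DGraph n F) : DGraph m F where
  toNGraph := X.toNGraph.relabel e
  γ := X.γ

/-- Applying a morphism of species to the decorations. -/
def push (θ : F ⟶ F') (X : DGraph n F) : DGraph n F' where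
  toNGraph := X.toNGraph
  γ := X.γ ≫ θ

lemma relabel_rel (e : m ≃ n) {X Y : DGraph n F} (h : Rel X Y) :
    Rel (X.relabel e) (Y.relabel e) := by
  obtain ⟨f, h1, h2⟩ := h
  exact ⟨f, fun x => h1 (e x), h2⟩

lemma push_rel (θ : F ⟶ F') {X Y : DGraph n F} (h : Rel X Y) : Rel (X.push θ) (Y.push θ) := by
  obtain ⟨f, h1, h2⟩ := h
  refine ⟨f, h1, ?_⟩
  exact (Category.assoc _ _ _).symm.trans (congrArg (· ≫ θ) h2)

lemma rel_of_eq {X Y : DGraph n F} (hG : X.G = Y.G) (hp : ∀ x, HEq (X.port x) (Y.port x))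
    (hγ : HEq X.γ Y.γ) : Rel X Y := by
  obtain ⟨⟨G, _, β⟩, γ⟩ := X
  obtain ⟨⟨G', _, β'⟩, γ'⟩ := Y
  cases hG
  cases hγ
  exact ⟨Iso.refl _, fun x => eq_of_heq (hp x), by simp⟩

/-- The value of the decoration at an arc of the corolla. -/
def valAt (X : DGraph n F) (x : n ⊕ n) : F.obj (.op .unit) := ev X.γ (X.G.arc (X.arcOf x))

lemma valAt_rel (x : n ⊕ n) {X Y : DGraph n F} (h : Rel X Y) : X.valAt x = Y.valAt x := by
  obtain ⟨f, h1, h2⟩ := h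
  rw [valAt, ← h2, ev_yo, arc_comp, valAt]
  congr 2
  cases x with
  | inl x => exact h1 x
  | inr x => exact (f.hom.a_i _).trans (congrArg Y.G.i (h1 x))

lemma valAt_swap (x : n ⊕ n) (X : DGraph n F) : X.valAt x.swap = F.res rev (X.valAt x) := by
  rw [valAt, NGraph.arcOf_swap, ev_arc_i, valAt]

end DGraph

/-- A morphism of corollas is a bijection of the sets of ports. -/
def equivOf {n m : Type} {hn : Finite n} {hm : Finite m} (u : El.cor m hm ⟶ El.cor n hn) : m ≃ n :=
  Equiv.ofBijective (Gr.Hom.h u) (by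
    have hu := Gr.Hom.cart u ()
    constructor
    · intro x y hxy
      exact (hu (Gr.Hom.h u y) rfl).unique ⟨rfl, hxy⟩ ⟨rfl, rfl⟩
    · intro y
      obtain ⟨x, hx, _⟩ := hu y rfl
      exact ⟨x, hx.2⟩)

lemma cor_a {n m : Type} {hn : Finite n} {hm : Finite m} (u : El.cor m hm ⟶ El.cor n hn)
    (x : m ⊕ m) : Gr.Hom.a u x = Sum.map (equivOf u) (equivOf u) x := by
  cases x with
  | inr x => exact Gr.Hom.a_s u x
  | inl x => exact (Gr.Hom.a_i u (Sum.inr x)).trans (congrArg Sum.swap (Gr.Hom.a_s u x))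

/-- The values of the species `bar F`: the same colours as `F`, and as `n`-operations the
isomorphism classes of effective `n`-graphs decorated by `F`. -/
def BarVal (F : Species) : El → Type 1
  | .unit => F.obj (.op .unit)
  | .cor n _ => DGraph.Cls n F

/-- The restriction maps of the species `bar F`. -/
def barRes (F : Species) : ∀ {E E' : El}, (E' ⟶ E) → BarVal F E → BarVal F E'
  | .unit, .unit, u => F.res u
  | .unit, .cor _ _, u => (Gr.Hom.v u ()).elim
  | .cor _ _, .unit, u => Quotient.lift (fun X => X.valAt (Gr.Hom.a u true))
      (fun _ _ h => DGraph.valAt_rel _ h)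
  | .cor _ _, .cor _ _, u => Quotient.map (DGraph.relabel (equivOf u))
      (fun _ _ h => DGraph.relabel_rel _ h)

lemma barRes_id (F : Species) (E : El) (x : BarVal F E) : barRes F (𝟙 E) x = x := by
  match E, x with
  | .unit, x => exact res_id F x
  | .cor n hn, x =>
    induction x using Quotient.ind with | _ X
    exact Quotient.sound (DGraph.rel_of_eq rfl (fun _ => HEq.rfl) HEq.rfl)

lemma barRes_comp (F : Species) {E E' E'' : El} (u : E' ⟶ E) (w : E'' ⟶ E') (x : BarVal F E) :
    barRes F (w ≫ u) x = barRes F w (barRes F u x) := by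
  match E, E', E'', u, w, x with
  | .unit, .unit, .unit, u, w, x => exact (res_res F u w x).symm
  | .unit, .unit, .cor _ _, u, w, x => exact (Gr.Hom.v w ()).elim
  | .unit, .cor _ _, _, u, w, x => exact (Gr.Hom.v u ()).elim
  | .cor _ _, .unit, .cor _ _, u, w, x => exact (Gr.Hom.v w ()).elim
  | .cor n hn, .unit, .unit, u, w, x =>
    induction x using Quotient.ind with | _ X
    change X.valAt (Gr.Hom.a u (Gr.Hom.a w true)) = F.res w (X.valAt (Gr.Hom.a u true))
    cases hb : Gr.Hom.a w true with
    | true =>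
      have : w = 𝟙 El.unit := unit_hom_ext hb
      rw [this, res_id]
    | false =>
      have : w = rev := unit_hom_ext hb
      rw [this, ← DGraph.valAt_swap]
      exact congrArg X.valAt (Gr.Hom.a_i u true)
  | .cor n hn, .cor m hm, .unit, u, w, x =>
    induction x using Quotient.ind with | _ X
    change X.valAt (Gr.Hom.a u (Gr.Hom.a w true)) =
      (X.relabel (equivOf u)).valAt (Gr.Hom.a w true)
    rw [cor_a]
    generalize Gr.Hom.a w true = b
    cases b <;> rfl
  | .cor n hn, .cor m hm, .cor k hk, u, w, x =>
    induction x using Quotient.ind with | _ X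
    exact Quotient.sound (DGraph.rel_of_eq rfl (fun _ => HEq.rfl) HEq.rfl)

/-- The species of isomorphism classes of effective graphs decorated by `F`. -/
def bar (F : Species) : Species where
  obj E := BarVal F E.unop
  map u := TypeCat.ofHom (barRes F u.unop)
  map_id E := by ext x; exact barRes_id F E.unop x
  map_comp u w := by ext x; exact barRes_comp F u.unop w.unop x

/-- The functoriality of `bar`, on values. -/
def barApp {F F' : Species} (θ : F ⟶ F') : ∀ E : El, BarVal F E → BarVal F' E
  | .unit => θ.app (.op .unit)
  | .cor _ _ => Quotient.map (DGraph.push θ) (fun _ _ h => DGraph.push_rel θ h)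

/-- Morphisms of the form `bar F ⟶ F'` (constructor unfolding the definitions). -/
def barHomMk {F F' : Species} (f : ∀ E, BarVal F E → F'.obj (.op E))
    (hf : ∀ {E E' : El} (u : E' ⟶ E) (x : BarVal F E), f E' (barRes F u x) = F'.res u (f E x)) :
    bar F ⟶ F' where
  app E := TypeCat.ofHom (f E.unop)
  naturality E E' u := by ext x; exact hf u.unop x

/-- The functoriality of `bar`. -/
def barMap {F F' : Species} (θ : F ⟶ F') : bar F ⟶ bar F' :=
  barHomMk (barApp θ) (by
    intro E E' u x
    change _ = barRes F' u (barApp θ E x)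
    match E, E', u, x with
    | .unit, .unit, u, x => exact app_res θ u x
    | .unit, .cor _ _, u, x => exact (Gr.Hom.v u ()).elim
    | .cor _ _, .unit, u, x =>
      induction x using Quotient.ind with | _ X
      rfl
    | .cor _ _, .cor _ _, u, x =>
      induction x using Quotient.ind with | _ X
      rfl)

lemma bar_ext {F F' : Species} {f g : bar F ⟶ F'}
    (h1 : ∀ x : F.obj (.op .unit), f.app (.op .unit) x = g.app (.op .unit) x)
    (h2 : ∀ (n : Type) (hn : Finite n) (X : DGraph n F),
      f.app (.op (.cor n hn)) X.cls = g.app (.op (.cor n hn)) X.cls) : f = g := by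
  ext E x
  induction E using Opposite.rec with | _ E
  match E, x with
  | .unit, x => exact h1 x
  | .cor n hn, x =>
    induction x using Quotient.ind with | _ X
    exact h2 n hn X

/-- The functor `F ↦ bar F`, with `bar F` having the same colours as `F` and, as `n`-operations, the
isomorphism classes of effective `n`-graphs decorated by `F`. -/
def barFunctor : Species ⥤ Species where
  obj := bar
  map := barMap
  map_id _ := bar_ext (fun _ => rfl) fun _ _ _ =>
    Quotient.sound (DGraph.rel_of_eq rfl (fun _ => HEq.rfl) HEq.rfl)
  map_comp _ _ := bar_ext (fun _ => rfl) fun _ _ _ =>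
    Quotient.sound (DGraph.rel_of_eq rfl (fun _ => HEq.rfl) HEq.rfl)

section cocones

/-- The map on corollas induced by an etale morphism. -/
def atMap {X Y : Gr} (f : X ⟶ Y) (w : X.V) : X.elAt w ⟶ Y.elAt (f.v w) :=
  fac (X.corAt w ≫ f)

lemma atMap_comp {X Y : Gr} (f : X ⟶ Y) (w : X.V) :
    (show (X.elAt w).gr ⟶ (Y.elAt (f.v w)).gr from atMap f w) ≫ Y.corAt (f.v w) =
      X.corAt w ≫ f :=
  fac_comp _

lemma equivOf_atMap {X Y : Gr} (f : X ⟶ Y) (w : X.V) (h : X.Fl w) :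
    (equivOf (atMap f w) h).1 = f.h h.1 :=
  congrArg (fun t : (X.elAt w).gr ⟶ Y => t.h h) (atMap_comp f w)

/-- A morphism of species `δ : G ⟶ bar F`, together with representatives for its values at the
vertices of `G`, gives a cocone. -/
def cocOf {G : Gr} {F : Species} (δ : yo.obj G ⟶ bar F) (K : ∀ v, DGraph (G.Fl v) F)
    (hK : ∀ v, (K v).cls = ev δ (G.corAt v)) :
    Coc G (fun v => (K v).G) (fun v => (K v).port) F where
  γ v := (K v).γ
  d x := ev δ (G.arc x)
  d_i x := ev_arc_i δ x
  compat v h := by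
    have h1 : (bar F).res (rev ≫ out h) (ev δ (G.corAt v)) = ev δ (G.arc (G.i (G.s h.1))) := by
      rw [← res_res, ← ev_arc_s, ← ev_arc_i]
    rw [← h1, ← hK, rev_out]
    rfl

variable {G : Gr} {F : Species}

/-- Conversely, cocones define morphisms of species into `bar F`. -/
def toBar (K : ∀ v, NGraph (G.Fl v)) (c : Coc G (fun v => (K v).G) (fun v => (K v).port) F) :
    yo.obj G ⟶ bar F :=
  DecData.hom
    { d := c.d
      c := fun w => DGraph.cls ⟨K w, c.γ w⟩
      d_i := c.d_i
      d_s := fun w h => by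
        change c.d (G.s h.1) = ev (c.γ w) ((K w).G.arc ((K w).G.i ((K w).port h)))
        rw [ev_arc_i, c.compat, ← c.d_i, Gr.i_i] }

lemma toBar_arc (K : ∀ v, NGraph (G.Fl v))
    (c : Coc G (fun v => (K v).G) (fun v => (K v).port) F) (x : G.A) :
    ev (toBar K c) (G.arc x) = c.d x := rfl

lemma toBar_cor (K : ∀ v, NGraph (G.Fl v))
    (c : Coc G (fun v => (K v).G) (fun v => (K v).port) F) (w : G.V) :
    ev (toBar K c) (G.corAt w) = DGraph.cls ⟨K w, c.γ w⟩ := DecData.hom_cor _ w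

/-- Restriction of the substituted graphs along an etale morphism. -/
def pullN {X : Gr} (f : X ⟶ G) (M : ∀ y, NGraph (G.Fl y)) (w : X.V) : NGraph (X.Fl w) :=
  (M (f.v w)).relabel (equivOf (atMap f w))

/-- Restriction of a cocone along an etale morphism. -/
def Coc.pull {X : Gr} (f : X ⟶ G) {M : ∀ y, NGraph (G.Fl y)}
    (c : Coc G (fun v => (M v).G) (fun v => (M v).port) F) :
    Coc X (fun w => (pullN f M w).G) (fun w => (pullN f M w).port) F where
  γ w := c.γ (f.v w)
  d x := c.d (f.a x)
  d_i x := by rw [f.a_i, c.d_i]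
  compat w h := by
    refine (c.compat (f.v w) (equivOf (atMap f w) h)).trans (congrArg c.d ?_)
    rw [f.a_i, f.a_s, equivOf_atMap]

lemma toBar_pull {X : Gr} (f : X ⟶ G) (M : ∀ y, NGraph (G.Fl y))
    (c : Coc G (fun v => (M v).G) (fun v => (M v).port) F) :
    toBar (pullN f M) (c.pull f) = yo.map f ≫ toBar M c := by
  refine dec_ext (fun a => ?_) (fun w => ?_)
  · rw [ev_yo, arc_comp]
    rfl
  · rw [ev_yo, ← atMap_comp, ← res_ev, toBar_cor, toBar_cor]
    rfl

lemma Coc.ext_hom {K : G.V → Gr} {b : ∀ v, G.Fl v → (K v).A} {S : Species}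
    {c : Coc G K b S} (hc : c.IsUniv) {k k' : S ⟶ F} (h1 : ∀ v, c.γ v ≫ k = c.γ v ≫ k')
    (h2 : ∀ x, k.app _ (c.d x) = k'.app _ (c.d x)) : k = k' :=
  (hc F (c.push k')).unique ⟨h1, h2⟩ ⟨fun _ => rfl, fun _ => rfl⟩

lemma Coc.uniq {K : G.V → Gr} {b : ∀ v, G.Fl v → (K v).A} {S S' : Gr}
    {c : Coc G K b (yo.obj S)} (hc : c.IsUniv) {c' : Coc G K b (yo.obj S')} (hc' : c'.IsUniv) :
    ∃ e : S ≅ S', (∀ v, c.γ v ≫ yo.map e.hom = c'.γ v) ∧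
      ∀ x, (yo.map e.hom).app _ (c.d x) = c'.d x := by
  obtain ⟨k, ⟨k1, k2⟩, -⟩ := hc _ c'
  obtain ⟨l, ⟨l1, l2⟩, -⟩ := hc' _ c
  have kl : k ≫ l = 𝟙 _ := Coc.ext_hom hc
    (fun v => by rw [← Category.assoc, k1, l1, Category.comp_id])
    (fun x => by
      change l.app _ (k.app _ (c.d x)) = c.d x
      rw [k2, l2])
  have lk : l ≫ k = 𝟙 _ := Coc.ext_hom hc'
    (fun v => by rw [← Category.assoc, l1, k1, Category.comp_id])
    (fun x => by
      change k.app _ (l.app _ (c'.d x)) = c'.d x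
      rw [l2, k2])
  refine ⟨⟨unyo k, unyo l, yo_injective ?_, yo_injective ?_⟩, ?_⟩
  · rw [yo.map_comp, yo_unyo, yo_unyo, kl, yo.map_id]
  · rw [yo.map_comp, yo_unyo, yo_unyo, lk, yo.map_id]
  · simp only [yo_unyo]
    exact ⟨k1, k2⟩

/-- Replacing the graphs in a cocone by isomorphic ones. -/
def Coc.reidx {K K' : G.V → Gr} {b : ∀ v, G.Fl v → (K v).A} {b' : ∀ v, G.Fl v → (K' v).A}
    (f : ∀ v, K' v ≅ K v) (hf : ∀ v h, (f v).hom.a (b' v h) = b v h) (c : Coc G K b F) :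
    Coc G K' b' F where
  γ v := yo.map (f v).hom ≫ c.γ v
  d := c.d
  d_i := c.d_i
  compat v h := by rw [ev_yo, arc_comp, hf, c.compat]

lemma Coc.reidx_isUniv {K K' : G.V → Gr} {b : ∀ v, G.Fl v → (K v).A}
    {b' : ∀ v, G.Fl v → (K' v).A} (f : ∀ v, K' v ≅ K v)
    (hf : ∀ v h, (f v).hom.a (b' v h) = b v h) {S : Species} {c : Coc G K b S} (hc : c.IsUniv) :
    (c.reidx f hf).IsUniv := by
  intro F c'
  have hf' : ∀ v h, (f v).symm.hom.a (b v h) = b' v h := fun v h => by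
    rw [← hf, ← comp_a]; simp
  have key : ∀ v (k : S ⟶ F), (c.reidx f hf).γ v ≫ k = c'.γ v ↔
      c.γ v ≫ k = (c'.reidx (fun v => (f v).symm) hf').γ v := by
    intro v k
    change (yo.map (f v).hom ≫ c.γ v) ≫ k = _ ↔ _ = yo.map (f v).inv ≫ c'.γ v
    rw [Category.assoc]
    constructor
    · rintro h
      rw [← h, ← Category.assoc, ← yo.map_comp]; simp
    · rintro h
      rw [h, ← Category.assoc, ← yo.map_comp]; simp
  obtain ⟨k, ⟨k1, k2⟩, k3⟩ := hc F (c'.reidx (fun v => (f v).symm) hf')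
  exact ⟨k, ⟨fun v => (key v k).2 (k1 v), k2⟩, fun l hl => k3 l ⟨fun v => (key v l).1 (hl.1 v), hl.2⟩⟩

/-- Restricting a colimit cocone along an isomorphism gives a colimit cocone. -/
lemma Coc.pull_isUniv {X : Gr} (f : X ≅ G) {M : ∀ y, NGraph (G.Fl y)} {S : Species}
    {c : Coc G (fun v => (M v).G) (fun v => (M v).port) S} (hc : c.IsUniv) :
    (c.pull f.hom).IsUniv := by
  intro F c'
  have hv : ∀ v, f.hom.v (f.inv.v v) = v := fun v => by rw [← comp_v]; simp
  have hv' : ∀ v, f.inv.v (f.hom.v v) = v := fun v => by rw [← comp_v]; simp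
  have ha : ∀ v, f.hom.a (f.inv.a v) = v := fun v => by rw [← comp_a]; simp
  have ha' : ∀ v, f.inv.a (f.hom.a v) = v := fun v => by rw [← comp_a]; simp
  let eV : X.V ≃ G.V := ⟨f.hom.v, f.inv.v, hv', hv⟩
  let γ : ∀ v, yo.obj (M v).G ⟶ F :=
    Equiv.piCongrLeft (fun v => yo.obj (M v).G ⟶ F) eV c'.γ
  have hγ : ∀ v, γ (f.hom.v v) = c'.γ v :=
    Equiv.piCongrLeft_apply_apply (fun v => yo.obj (M v).G ⟶ F) eV c'.γ
  let c'' : Coc G (fun v => (M v).G) (fun v => (M v).port) F :=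
    { γ := γ
      d := fun x => c'.d (f.inv.a x)
      d_i := fun x => by rw [f.inv.a_i, c'.d_i]
      compat := fun v h => by
        obtain ⟨v, rfl⟩ := eV.surjective v
        obtain ⟨h, rfl⟩ := (equivOf (atMap f.hom v)).surjective h
        refine (congrArg (fun t => ev t _) (hγ v)).trans ((c'.compat v h).trans ?_)
        rw [equivOf_atMap, ← f.hom.a_s, ← f.hom.a_i, ha'] }
  obtain ⟨k, ⟨k1, k2⟩, k3⟩ := hc F c''
  refine ⟨k, ⟨fun v => (k1 (f.hom.v v)).trans (hγ v), fun x => ?_⟩, fun l hl => k3 l ⟨fun v => ?_, fun x => ?_⟩⟩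
  · exact (k2 (f.hom.a x)).trans (congrArg c'.d (ha' x))
  · obtain ⟨v, rfl⟩ := eV.surjective v
    exact (hl.1 v).trans (hγ v).symm
  · have := hl.2 (f.inv.a x)
    change l.app _ (c.d (f.hom.a (f.inv.a x))) = _ at this
    rwa [ha] at this

/-- Iterated colimits. -/
lemma Coc.iterate (K : ∀ v, NGraph (G.Fl v)) {S : Gr} (q : ∀ v, (K v).G ⟶ S) (a : G.A → S.A)
    (c : Coc G (fun v => (K v).G) (fun v => (K v).port) (yo.obj S)) (hc : c.IsUniv)
    (hq : ∀ v, c.γ v = yo.map (q v)) (ha : ∀ x, c.d x = ⟨S.arc (a x)⟩)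
    (hV : Function.Bijective (fun w : Σ v, (K v).G.V => (q w.1).v w.2))
    (M : ∀ y, NGraph (S.Fl y)) {Z : Species}
    (cM : Coc S (fun y => (M y).G) (fun y => (M y).port) Z) (hcM : cM.IsUniv)
    (P : G.V → Gr) (b : ∀ v, G.Fl v → (P v).A)
    (cP : ∀ v, Coc (K v).G (fun w => (pullN (q v) M w).G) (fun w => (pullN (q v) M w).port)
      (yo.obj (P v))) (hcP : ∀ v, (cP v).IsUniv)
    (hb : ∀ v h, (cP v).d ((K v).port h) = ⟨(P v).arc (b v h)⟩) :
    ∃ c' : Coc G P b Z, c'.IsUniv ∧ (∀ x, c'.d x = cM.d (a x)) ∧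
      (∀ v w, (cP v).γ w ≫ c'.γ v = cM.γ ((q v).v w)) ∧
      ∀ v x, (c'.γ v).app _ ((cP v).d x) = cM.d ((q v).a x) := by
  have hqa : ∀ v (h : G.Fl v), (q v).a ((K v).port h) = a (G.i (G.s h.1)) := by
    intro v h
    have := c.compat v h
    rw [hq, ha] at this
    exact congrArg (fun t : ULift (El.unit.gr ⟶ S) => t.down.a true) this
  have hai : ∀ x, a (G.i x) = S.i (a x) := by
    intro x
    have := c.d_i x
    rw [ha, ha] at this
    exact congrArg (fun t : ULift (El.unit.gr ⟶ S) => t.down.a true) this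
  choose g hg _ using fun v => hcP v Z (cM.pull (q v))
  let c' : Coc G P b Z :=
    { γ := g
      d := fun x => cM.d (a x)
      d_i := fun x => by rw [hai, cM.d_i]
      compat := fun v h => by
        rw [← hqa]
        refine Eq.trans ?_ ((hg v).2 ((K v).port h))
        rw [hb]; rfl }
  refine ⟨c', ?_, fun _ => rfl, fun v => (hg v).1, fun v => (hg v).2⟩
  intro F c₁
  have hδc : ∀ v x, ev (toBar (pullN (q v) M) ((cP v).push (c₁.γ v))) ((K v).G.arc x) =
      (c₁.γ v).app _ ((cP v).d x) := fun v x => rfl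
  let c₂ : Coc G (fun v => (K v).G) (fun v => (K v).port) (bar F) :=
    { γ := fun v => toBar (pullN (q v) M) ((cP v).push (c₁.γ v))
      d := c₁.d
      d_i := c₁.d_i
      compat := fun v h => by
        rw [hδc, hb]
        exact c₁.compat v h }
  obtain ⟨δ, ⟨δ1, δ2⟩, δ3⟩ := hc _ c₂
  have hδq : ∀ v x, ev δ (S.arc ((q v).a x)) = (c₁.γ v).app _ ((cP v).d x) := by
    intro v x
    rw [← hδc, ← arc_comp, ← ev_yo, ← hq]
    exact congrArg (fun t => ev t ((K v).G.arc x)) (δ1 v)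
  have hδa : ∀ x, ev δ (S.arc (a x)) = c₁.d x := by
    intro x
    refine Eq.trans ?_ (δ2 x)
    rw [ha]; rfl
  let eV : (Σ v, (K v).G.V) ≃ S.V := Equiv.ofBijective _ hV
  let γ : ∀ y, yo.obj (M y).G ⟶ F :=
    Equiv.piCongrLeft (fun y => yo.obj (M y).G ⟶ F) eV (fun w => (cP w.1).γ w.2 ≫ c₁.γ w.1)
  have hγ : ∀ v w, γ ((q v).v w) = (cP v).γ w ≫ c₁.γ v := fun v w =>
    Equiv.piCongrLeft_apply_apply (fun y => yo.obj (M y).G ⟶ F) eV _ ⟨v, w⟩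
  let c₃ : Coc S (fun y => (M y).G) (fun y => (M y).port) F :=
    { γ := γ
      d := fun x => ev δ (S.arc x)
      d_i := fun x => ev_arc_i δ x
      compat := fun y h => by
        obtain ⟨⟨v, w⟩, rfl⟩ := eV.surjective y
        obtain ⟨h, rfl⟩ := (equivOf (atMap (q v) w)).surjective h
        refine (congrArg (fun t => ev t _) (hγ v w)).trans ?_
        rw [equivOf_atMap, ← (q v).a_s, ← (q v).a_i, hδq]
        exact ((cP v).push (c₁.γ v)).compat w h }
  obtain ⟨k, ⟨k1, k2⟩, k3⟩ := hcM F c₃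
  refine ⟨k, ⟨fun v => Coc.ext_hom (hcP v) (fun w => ?_) (fun x => ?_), fun x => ?_⟩, ?_⟩
  · rw [← Category.assoc]
    refine (congrArg (· ≫ k) ((hg v).1 w)).trans ((k1 _).trans (hγ v w))
  · refine (congrArg (fun t => k.app _ t) ((hg v).2 x)).trans ((k2 _).trans (hδq v x))
  · exact (k2 (a x)).trans (hδa x)
  · rintro l ⟨l1, l2⟩
    have hl : ∀ v w, cM.γ ((q v).v w) ≫ l = (cP v).γ w ≫ c₁.γ v := fun v w => by
      rw [← l1, ← Category.assoc]
      exact congrArg (· ≫ l) ((hg v).1 w).symm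
    have hδ : toBar M (cM.push l) = δ := by
      refine δ3 _ ⟨fun v => ?_, fun x => ?_⟩
      · rw [hq, ← toBar_pull]
        refine dec_ext (fun x => ?_) (fun w => ?_)
        · rw [toBar_arc]
          change l.app _ (cM.d ((q v).a x)) = (c₁.γ v).app _ ((cP v).d x)
          rw [← l1]
          exact congrArg (fun t => l.app _ t) ((hg v).2 x).symm
        · rw [toBar_cor]
          refine Eq.trans ?_ (toBar_cor (pullN (q v) M) ((cP v).push (c₁.γ v)) w).symm
          exact congrArg (fun t => DGraph.cls ⟨pullN (q v) M w, t⟩) (hl v w)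
      · rw [ha]
        exact l2 x
    refine k3 l ⟨fun y => ?_, fun x => ?_⟩
    · obtain ⟨⟨v, w⟩, rfl⟩ := eV.surjective y
      exact (hl v w).trans (hγ v w).symm
    · change (toBar M (cM.push l)).app _ ⟨S.arc x⟩ = ev δ (S.arc x)
      rw [hδ]; rfl

end cocones

section multiplication

variable {n : Type} {F : Species}

/-- A representative of the decoration of a vertex. -/
def rep {G : Gr} (δ : yo.obj G ⟶ bar F) (v : G.V) : DGraph (G.Fl v) F :=
  Quotient.out (s := DGraph.setoid (G.Fl v) F) (ev δ (G.corAt v))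

lemma rep_cls {G : Gr} (δ : yo.obj G ⟶ bar F) (v : G.V) : (rep δ v).cls = ev δ (G.corAt v) :=
  Quotient.out_eq (s := DGraph.setoid (G.Fl v) F) _

/-- Given an `n`-graph `X` and an `F`-decorated graph `K v` for each vertex `v` of `X`, with matching
interfaces and colours, the colimit of the `K v` is an `F`-decorated `n`-graph. -/
def subst (X : DGraph n (bar F)) (K : ∀ v, DGraph (X.G.Fl v) F)
    (hK : ∀ v, (K v).cls = ev X.γ (X.G.corAt v)) : DGraph n F where
  G := glue X.G (fun v => (K v).toNGraph)
  eff := glue_effective _ _ X.eff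
  β := X.β.trans (gluePorts _ _)
  γ := glueDesc (cocOf X.γ K hK)

/-- Erasing the circles: the multiplication, on representatives. -/
def muFun (X : DGraph n (bar F)) : DGraph n F := subst X (rep X.γ) (rep_cls X.γ)

/-- Every colimit computes the multiplication. -/
lemma mu_eq (X : DGraph n (bar F)) (K : ∀ v, DGraph (X.G.Fl v) F)
    (hK : ∀ v, (K v).cls = ev X.γ (X.G.corAt v)) (Y : DGraph n F)
    (c : Coc X.G (fun v => (K v).G) (fun v => (K v).port) (yo.obj Y.G)) (hc : c.IsUniv)
    (hβ : ∀ x, c.d (X.port x) = ⟨Y.G.arc (Y.port x)⟩) (hγ : ∀ v, c.γ v ≫ Y.γ = (K v).γ)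
    (hd : ∀ x, Y.γ.app _ (c.d x) = ev X.γ (X.G.arc x)) : (muFun X).cls = Y.cls := by
  have hr : ∀ v, DGraph.Rel (rep X.γ v) (K v) := fun v =>
    DGraph.cls_eq.1 ((rep_cls X.γ v).trans (hK v).symm)
  choose f hf hfγ using hr
  let c₁ := c.reidx (b' := fun v => (rep X.γ v).port) f hf
  obtain ⟨e, e1, e2⟩ := Coc.uniq (glueCoc_isUniv X.G (fun v => (rep X.γ v).toNGraph))
    (c' := c₁) (Coc.reidx_isUniv f hf hc)
  refine DGraph.cls_eq.2 ⟨e, fun x => ?_, ?_⟩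
  · have := (e2 (X.port x)).trans (hβ x)
    exact congrArg (fun t : ULift (El.unit.gr ⟶ Y.G) => t.down.a true) this
  · refine Coc.ext_hom (glueCoc_isUniv X.G (fun v => (rep X.γ v).toNGraph)) (fun v => ?_)
      (fun x => ?_)
    · refine (Category.assoc _ _ _).symm.trans ((congrArg (· ≫ Y.γ) (e1 v)).trans ?_)
      change (yo.map (f v).hom ≫ c.γ v) ≫ Y.γ = _
      rw [Category.assoc, hγ, hfγ]
      exact (glueDesc_q (cocOf X.γ (rep X.γ) (rep_cls X.γ)) v).symm
    · refine (congrArg (fun t => Y.γ.app _ t) (e2 x)).trans ((hd x).trans ?_)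
      exact (glueDesc_d (cocOf X.γ (rep X.γ) (rep_cls X.γ)) x).symm

lemma mu_subst (X : DGraph n (bar F)) (K : ∀ v, DGraph (X.G.Fl v) F)
    (hK : ∀ v, (K v).cls = ev X.γ (X.G.corAt v)) : (muFun X).cls = (subst X K hK).cls :=
  mu_eq X K hK (subst X K hK) (glueCoc _ _) (glueCoc_isUniv _ _) (fun _ => rfl)
    (fun v => glueDesc_q (cocOf X.γ K hK) v) (fun x => glueDesc_d (cocOf X.γ K hK) x)

lemma muFun_rel {X X' : DGraph n (bar F)} (h : DGraph.Rel X X') :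
    DGraph.Rel (muFun X) (muFun X') := by
  obtain ⟨e, h1, h2⟩ := h
  refine DGraph.cls_eq.1 ?_
  let c : Coc X'.G (fun v => (rep X'.γ v).G) (fun v => (rep X'.γ v).port) (yo.obj (muFun X').G) :=
    glueCoc X'.G (fun v => (rep X'.γ v).toNGraph)
  have hc : c.IsUniv := glueCoc_isUniv X'.G (fun v => (rep X'.γ v).toNGraph)
  refine mu_eq X (fun v => (rep X'.γ (e.hom.v v)).relabel (equivOf (atMap e.hom v))) (fun v => ?_)
    (muFun X') (c.pull (M := fun v => (rep X'.γ v).toNGraph) e.hom)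
    (Coc.pull_isUniv (M := fun v => (rep X'.γ v).toNGraph) e hc) (fun x => ?_) (fun v => ?_)
    (fun x => ?_)
  · rw [← h2, ev_yo, ← atMap_comp, ← res_ev, ← rep_cls]
    rfl
  · change c.d (e.hom.a (X.port x)) = _
    rw [h1]
    rfl
  · exact glueDesc_q (cocOf X'.γ (rep X'.γ) (rep_cls X'.γ)) (e.hom.v v)
  · rw [← h2, ev_yo, arc_comp]
    exact glueDesc_d (cocOf X'.γ (rep X'.γ) (rep_cls X'.γ)) (e.hom.a x)

/-- The multiplication, on values. -/
def muVal (F : Species) : ∀ E, BarVal (bar F) E → BarVal F E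
  | .unit => id
  | .cor _ _ => Quotient.map muFun (fun _ _ h => muFun_rel h)

/-- The multiplication of the monad. -/
def muApp (F : Species) : bar (bar F) ⟶ bar F :=
  barHomMk (muVal F) (by
    intro E E' u x
    change _ = barRes F u (muVal F E x)
    match E, E', u, x with
    | .unit, .unit, u, x => rfl
    | .unit, .cor _ _, u, x => exact (Gr.Hom.v u ()).elim
    | .cor _ _, .unit, u, x =>
      induction x using Quotient.ind with | _ X
      change X.valAt (Gr.Hom.a u true) = (muFun X).valAt (Gr.Hom.a u true)
      generalize Gr.Hom.a u true = b
      have h := glueDesc_d (cocOf X.γ (rep X.γ) (rep_cls X.γ))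
      cases b with
      | inl x => exact (h _).symm
      | inr x => exact (h _).symm
    | .cor _ _, .cor _ _, u, x =>
      induction x using Quotient.ind with | _ X
      rfl)

/-- The morphism of species corresponding to an element by the Yoneda lemma. -/
def ofElt {E : El} (x : F.obj (.op E)) : yo.obj E.gr ⟶ F where
  app E' := TypeCat.ofHom fun u => F.res (E' := E'.unop) u.down x
  naturality E' E'' w := by
    ext u
    exact (res_res F (E' := E'.unop) (E'' := E''.unop) u.down w.unop x).symm

lemma corolla_effective (n : Type) (hn : Finite n) : (Gr.corolla n hn).Effective := by
  refine ⟨.inr ⟨()⟩, ?_⟩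
  rintro (x | x) ⟨h1, h2⟩
  · exact h2 ⟨x, rfl⟩
  · exact h1 ⟨x, rfl⟩

/-- A corolla as an `n`-graph. -/
def corN (n : Type) (hn : Finite n) : NGraph n where
  G := Gr.corolla n hn
  eff := corolla_effective n hn
  β := Equiv.ofBijective (fun x => ⟨Sum.inl x, fun ⟨y, hy⟩ => by cases hy⟩) <| by
    constructor
    · intro x y h
      exact Sum.inl.inj (congrArg Subtype.val h)
    · rintro ⟨x | x, h⟩
      · exact ⟨x, rfl⟩
      · exact (h ⟨x, rfl⟩).elim

/-- A decorated corolla. -/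
def etaFun {n : Type} (hn : Finite n) (x : F.obj (.op (.cor n hn))) : DGraph n F where
  toNGraph := corN n hn
  γ := ofElt x

/-- The unit of the monad, on values: an operation of `F` is interpreted as a decorated corolla. -/
def etaVal (F : Species) : ∀ E : El, F.obj (.op E) → BarVal F E
  | .unit => id
  | .cor _ hn => fun x => (etaFun hn x).cls

lemma arcOf_corN {n : Type} {hn : Finite n} (x : n ⊕ n) : (corN n hn).arcOf x = x := by
  cases x <;> rfl

/-- Isomorphism of corollas from a bijection of ports. -/
def corIso {n m : Type} {hn : Finite n} {hm : Finite m} (e : m ≃ n) :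
    Gr.corolla m hm ≅ Gr.corolla n hn where
  hom :=
    { a := Sum.map e e, h := e, v := id
      a_i := by rintro (x | x) <;> rfl
      a_s := fun _ => rfl
      v_p := fun _ => rfl
      cart := fun _ k _ => ⟨e.symm k, ⟨rfl, e.apply_symm_apply k⟩, fun y hy => by
        rw [← hy.2, e.symm_apply_apply]⟩ }
  inv :=
    { a := Sum.map e.symm e.symm, h := e.symm, v := id
      a_i := by rintro (x | x) <;> rfl
      a_s := fun _ => rfl
      v_p := fun _ => rfl
      cart := fun _ k _ => ⟨e k, ⟨rfl, e.symm_apply_apply k⟩, fun y hy => by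
        rw [← hy.2, e.apply_symm_apply]⟩ }
  hom_inv_id := cor_hom_ext (hn := hm) rfl fun x => e.symm_apply_apply x
  inv_hom_id := cor_hom_ext (hn := hn) rfl fun x => e.apply_symm_apply x

/-- The unit of the monad. -/
def etaApp (F : Species) : F ⟶ bar F where
  app E := TypeCat.ofHom (etaVal F E.unop)
  naturality E E' u := by
    induction E using Opposite.rec with | _ E
    induction E' using Opposite.rec with | _ E'
    obtain ⟨u, rfl⟩ : ∃ w : E' ⟶ E, u = w.op := ⟨u.unop, rfl⟩
    ext x
    change etaVal F E' (F.res u x) = barRes F u (etaVal F E x)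
    match E, E', u, x with
    | .unit, .unit, u, x => rfl
    | .unit, .cor _ _, u, x => exact (Gr.Hom.v u ()).elim
    | .cor n hn, .unit, u, x =>
      change F.res u x = F.res _ x
      congr 1
      exact unit_hom_ext (arcOf_corN (hn := hn) (Gr.Hom.a u true)).symm
    | .cor n hn, .cor m hm, u, x =>
      refine DGraph.cls_eq.2 ⟨corIso (equivOf u), fun x => rfl, ?_⟩
      have hu : (corIso (hn := hn) (hm := hm) (equivOf u)).hom = u := cor_hom_ext rfl fun _ => rfl
      refine ev_ext fun E t => ?_
      have key : ∀ z : Gr.corolla m hm ⟶ Gr.corolla n hn, z = u →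
          ev (yo.map z ≫ ofElt x) t = ev (ofElt (F.res u x)) t := by
        rintro z rfl
        exact (res_res F (E := El.cor n hn) (E' := El.cor m hm) z t x).symm
      exact key _ hu

lemma mu_eta_left {n : Type} (hn : Finite n) (X : DGraph n F) :
    (muFun (etaFun (F := bar F) hn X.cls)).cls = X.cls := by
  let G := Gr.corolla n hn
  let K : ∀ v : G.V, DGraph (G.Fl v) F := fun v => X.relabel (equivOf (hn := hn) (G.corAt v))
  let c : Coc G (fun v => (K v).G) (fun v => (K v).port) (yo.obj X.G) :=
    { γ := fun _ => 𝟙 _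
      d := fun x => ⟨X.G.arc (X.arcOf x)⟩
      d_i := fun x => congrArg ULift.up
        ((congrArg X.G.arc (X.arcOf_swap x)).trans (rev_comp_arc _ _).symm)
      compat := fun v h => rfl }
  have hc : c.IsUniv := by
    intro F' c'
    have h1 : ∀ x : n, ev (c'.γ ()) (X.G.arc (X.port x)) = c'.d (Sum.inl x) :=
      fun x => c'.compat () ⟨x, rfl⟩
    refine ⟨c'.γ (), ⟨fun v => Category.id_comp _, ?_⟩, fun k hk => ?_⟩
    · rintro (x | x)
      · exact h1 x
      · refine (ev_arc_i (c'.γ ()) (X.port x)).trans ?_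
        exact (congrArg (F'.res rev) (h1 x)).trans (c'.d_i (Sum.inl x)).symm
    · exact (Category.id_comp k).symm.trans (hk.1 ())
  exact mu_eq (etaFun (F := bar F) hn X.cls) K (fun v => rfl) X c hc (fun _ => rfl)
    (fun v => Category.id_comp _) (fun _ => rfl)

/-- The canonical cocone exhibiting a graph as the colimit of its corollas. -/
def corCoc (G : Gr) (y : ∀ v, F.obj (.op (G.elAt v))) :
    Coc G (fun v => (etaFun (G.finite_fl v) (y v)).G) (fun v => (etaFun (G.finite_fl v) (y v)).port)
      (yo.obj G) where
  γ v := yo.map (G.corAt v)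
  d x := ⟨G.arc x⟩
  d_i _ := congrArg ULift.up (rev_comp_arc _ _).symm
  compat _ _ := congrArg ULift.up (unit_hom_ext rfl)

lemma corCoc_isUniv (G : Gr) (y : ∀ v, F.obj (.op (G.elAt v))) : (corCoc G y).IsUniv := by
  intro F' c'
  let D : DecData G F' :=
    { d := c'.d
      c := fun w => ev (c'.γ w) (𝟙 _)
      d_i := c'.d_i
      d_s := fun w h => by
        have h1 : ev (c'.γ w) ((G.elAt w).gr.arc (Sum.inl h)) = c'.d (G.i (G.s h.1)) :=
          c'.compat w h
        refine Eq.trans ?_ (res_ev (c'.γ w) (out h) (𝟙 _)).symm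
        refine Eq.trans ?_ (ev_arc_i (c'.γ w) (Sum.inl h)).symm
        refine Eq.trans ?_ (congrArg (F'.res rev) h1).symm
        rw [← c'.d_i, Gr.i_i] }
  refine ⟨D.hom, ⟨fun v => ?_, fun x => rfl⟩, fun k hk => ?_⟩
  · refine ev_ext fun E u => ?_
    have h1 : _ = ev (yo.map (G.corAt v) ≫ D.hom) u :=
      res_ev (yo.map (G.corAt v) ≫ D.hom) (E := G.elAt v) u (𝟙 _)
    have h2 : _ = ev (c'.γ v) u := res_ev (c'.γ v) (E := G.elAt v) u (𝟙 _)
    have h3 : ev (yo.map (G.corAt v) ≫ D.hom) (𝟙 (G.elAt v).gr) = ev (c'.γ v) (𝟙 _) :=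
      D.hom_cor v
    exact h1.symm.trans ((congrArg (F'.res (E := G.elAt v) u) h3).trans h2)
  · refine dec_ext (fun a => hk.2 a) (fun w => ?_)
    rw [D.hom_cor]
    exact congrArg (fun t => ev t (𝟙 (G.elAt w).gr)) (hk.1 w)

lemma mu_eta_right {n : Type} (X : DGraph n F) : (muFun (X.push (etaApp F))).cls = X.cls :=
  mu_eq (X.push (etaApp F)) (fun v => etaFun (X.G.finite_fl v) (ev X.γ (X.G.corAt v)))
    (fun _ => rfl) X (corCoc X.G (fun v => ev X.γ (X.G.corAt v))) (corCoc_isUniv X.G _)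
    (fun _ => rfl)
    (fun v => ev_ext fun _ u => (res_ev X.γ (E := X.G.elAt v) u (X.G.corAt v)).symm) (fun _ => rfl)

/-- Restricting representatives along an etale morphism. -/
lemma rep_pull {G X : Gr} (f : X ⟶ G) (δ : yo.obj G ⟶ bar F) (M : ∀ v, DGraph (G.Fl v) F)
    (hM : ∀ v, (M v).cls = ev δ (G.corAt v)) (w : X.V) :
    ((M (f.v w)).relabel (equivOf (atMap f w))).cls = ev (yo.map f ≫ δ) (X.corAt w) := by
  rw [ev_yo, ← atMap_comp, ← res_ev, ← hM]
  rfl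

/-- Substituting a substitution. Here `S` is a colimit of graphs `K v` along `G`, the graph `Z` is a
colimit of graphs `M y` along `S`, and the result is that `Z` is a colimit, along `G`, of the
colimits of the `M y` along the `K v`. -/
lemma subst_iterate {G : Gr} (K : ∀ v, DGraph (G.Fl v) (bar F)) {S : Gr}
    (c : Coc G (fun v => (K v).G) (fun v => (K v).port) (yo.obj S)) (hc : c.IsUniv)
    (q : ∀ v, (K v).G ⟶ S) (a : G.A → S.A)
    (hq : ∀ v, c.γ v = yo.map (q v)) (ha : ∀ x, c.d x = ⟨S.arc (a x)⟩)
    (hV : Function.Bijective (fun w : Σ v, (K v).G.V => (q w.1).v w.2))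
    (δ : yo.obj S ⟶ bar F) (hδ : ∀ v, yo.map (q v) ≫ δ = (K v).γ)
    (M : ∀ y, DGraph (S.Fl y) F) (hM : ∀ y, (M y).cls = ev δ (S.corAt y))
    {Z : Species} (cM : Coc S (fun y => (M y).G) (fun y => (M y).port) Z) (hcM : cM.IsUniv) :
    ∃ (P : ∀ v, DGraph (G.Fl v) F) (_ : ∀ v, (P v).cls = (muFun (K v)).cls)
      (c' : Coc G (fun v => (P v).G) (fun v => (P v).port) Z),
      c'.IsUniv ∧ (∀ x, c'.d x = cM.d (a x)) ∧
        ∀ θ : Z ⟶ F, (∀ y, cM.γ y ≫ θ = (M y).γ) →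
          (∀ x, θ.app _ (cM.d x) = ev δ (S.arc x)) → ∀ v, c'.γ v ≫ θ = (P v).γ := by
  have hL : ∀ v w, ((M ((q v).v w)).relabel (equivOf (atMap (q v) w))).cls =
      ev (K v).γ ((K v).G.corAt w) := fun v w => by
    rw [← hδ v]; exact rep_pull (q v) δ M hM w
  let P : ∀ v, DGraph (G.Fl v) F := fun v => subst (K v) _ (hL v)
  let N : ∀ y, NGraph (S.Fl y) := fun y => (M y).toNGraph
  let cP : ∀ v, Coc (K v).G (fun w => (pullN (q v) N w).G) (fun w => (pullN (q v) N w).port)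
      (yo.obj (P v).G) := fun v => glueCoc (K v).G (pullN (q v) N)
  have hcP : ∀ v, (cP v).IsUniv := fun v => glueCoc_isUniv (K v).G (pullN (q v) N)
  obtain ⟨c', h1, h2, h3, h4⟩ := Coc.iterate (fun v => (K v).toNGraph) q a c hc hq ha hV N cM hcM
    (fun v => (P v).G) (fun v => (P v).port) cP hcP (fun v h => rfl)
  refine ⟨P, fun v => (mu_subst (K v) _ (hL v)).symm, c', h1, h2, fun θ hθ hθ' v => ?_⟩
  refine Coc.ext_hom (hcP v) (fun w => ?_) (fun x => ?_)
  · refine (Category.assoc _ _ _).symm.trans ((congrArg (· ≫ θ) (h3 v w)).trans ((hθ _).trans ?_))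
    exact (glueDesc_q (cocOf (K v).γ _ (hL v)) w).symm
  · refine (congrArg (fun t => θ.app _ t) (h4 v x)).trans ((hθ' _).trans ?_)
    refine Eq.trans ?_ (glueDesc_d (cocOf (K v).γ _ (hL v)) x).symm
    change _ = ev (K v).γ ((K v).G.arc x)
    rw [← hδ, ev_yo, arc_comp]

lemma mu_assoc {n : Type} (X : DGraph n (bar (bar F))) :
    (muFun (X.push (muApp F))).cls = (muFun (muFun X)).cls := by
  let K := rep X.γ
  let c := glueCoc X.G (fun v => (K v).toNGraph)
  have hd := glueDesc_d (cocOf X.γ K (rep_cls X.γ))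
  have hq := glueDesc_q (cocOf X.γ K (rep_cls X.γ))
  let S := muFun X
  let M := rep S.γ
  have hV : Function.Bijective (fun w : Σ v, (K v).G.V =>
      (glueQ X.G (fun v => (K v).toNGraph) w.1).v w.2) := Function.bijective_id
  obtain ⟨P, hP, c', h1, h2, h3⟩ := subst_iterate K c (glueCoc_isUniv _ _)
    (glueQ X.G (fun v => (K v).toNGraph)) (fun x => .inl x) (fun _ => rfl) (fun _ => rfl) hV
    S.γ (fun v => hq v) M (rep_cls S.γ) (glueCoc S.G (fun y => (M y).toNGraph))
    (glueCoc_isUniv _ _)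
  have hd' := glueDesc_d (cocOf S.γ M (rep_cls S.γ))
  refine mu_eq (X.push (muApp F)) P (fun v => ?_) (muFun S) c' h1 (fun x => ?_)
    (h3 (muFun S).γ (fun y => glueDesc_q (cocOf S.γ M (rep_cls S.γ)) y) hd') (fun x => ?_)
  · refine (hP v).trans ?_
    exact congrArg (muVal F (X.G.elAt v)) (rep_cls X.γ v)
  · exact h2 _
  · exact (congrArg (fun t => (muFun S).γ.app _ t) (h2 x)).trans ((hd' _).trans (hd x))

/-- The monad on graphical species whose algebras are the compact coloured props. -/
def ccp : Monad Species where
  toFunctor := barFunctor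
  η :=
    { app := etaApp
      naturality := fun F F' θ => by
        ext E x
        induction E using Opposite.rec with | _ E
        match E, x with
        | .unit, x => rfl
        | .cor n hn, x =>
          refine DGraph.cls_eq.2 ⟨Iso.refl _, fun _ => rfl, ?_⟩
          refine ev_ext fun E t => ?_
          exact (app_res θ (show E ⟶ El.cor n hn from t) x) }
  μ :=
    { app := muApp
      naturality := fun F F' θ => by
        refine bar_ext (fun _ => rfl) fun n hn X => ?_
        change (muFun (X.push (barMap θ))).cls = ((muFun X).push θ).cls
        refine mu_eq (X.push (barMap θ)) (fun v => (rep X.γ v).push θ) (fun v => ?_)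
          ((muFun X).push θ) (glueCoc X.G (fun v => (rep X.γ v).toNGraph))
          (glueCoc_isUniv X.G (fun v => (rep X.γ v).toNGraph)) (fun _ => rfl)
          (fun v => ?_) (fun x => ?_)
        · exact congrArg (barApp θ (X.G.elAt v)) (rep_cls X.γ v)
        · exact congrArg (· ≫ θ) (glueDesc_q (cocOf X.γ (rep X.γ) (rep_cls X.γ)) v)
        · exact congrArg (fun t => θ.app _ t) (glueDesc_d (cocOf X.γ (rep X.γ) (rep_cls X.γ)) x) }
  left_unit F := by
    refine bar_ext (fun _ => rfl) fun n hn X => ?_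
    change (muFun (etaFun (F := bar F) hn X.cls)).cls = X.cls
    exact mu_eta_left hn X
  right_unit F := by
    refine bar_ext (fun _ => rfl) fun n hn X => ?_
    change (muFun (X.push (etaApp F))).cls = X.cls
    exact mu_eta_right X
  assoc F := by
    refine bar_ext (fun _ => rfl) fun n hn X => ?_
    change (muFun (X.push (muApp F))).cls = (muFun (muFun X)).cls
    exact mu_assoc X

end multiplication

/-- The restricted Kleisli category: the full subcategory of the Kleisli category of the monad
whose objects are the graphs without isolated edges. -/
abbrev KlGr := InducedCategory (Kleisli ccp)
  (fun R : {G : Gr // G.NoIsolatedEdges} => Kleisli.mk ccp (yo.obj R.1))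

/-- The morphism of species `R ⟶ bar Y` underlying a Kleisli morphism from `R` to `Y`. -/
def KlGr.toBar {R Y : KlGr} (φ : R ⟶ Y) :
    yo.obj (Subtype.val (p := Gr.NoIsolatedEdges) R) ⟶
      bar (yo.obj (Subtype.val (p := Gr.NoIsolatedEdges) Y)) := φ.hom.of

/-- A Kleisli morphism `R ⟶ bar Y` assigns to each vertex of `R` a graph etale over `Y`; the colimit
of these graphs, glued as `R` is glued from its corollas. -/
abbrev colimGraph {R Y : Gr} (φ : yo.obj R ⟶ bar (yo.obj Y)) : Gr :=
  glue R (fun v => (rep φ v).toNGraph)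

/-- The canonical etale morphism from the colimit to `Y`. -/
def colimMap {R Y : Gr} (φ : yo.obj R ⟶ bar (yo.obj Y)) : colimGraph φ ⟶ Y :=
  unyo (glueDesc (cocOf φ (rep φ) (rep_cls φ)))

/-- A Kleisli morphism from `R` to `Y` is generic if the etale morphism to `Y` from the colimit
graph is invertible. -/
def generic : MorphismProperty KlGr := fun _ _ φ => IsIso (colimMap (KlGr.toBar φ))

section generic

lemma Coc.isUniv_congr {G : Gr} {K : G.V → Gr} {b : ∀ v, G.Fl v → (K v).A} {S : Species}
    {c c' : Coc G K b S} (hc : c.IsUniv) (h1 : ∀ v, c.γ v = c'.γ v) (h2 : ∀ x, c.d x = c'.d x) :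
    c'.IsUniv := by
  have : c = c' := by
    cases c; cases c'
    obtain rfl := funext h1
    obtain rfl := funext h2
    rfl
  exact this ▸ hc

lemma Coc.push_isUniv {G : Gr} {K : G.V → Gr} {b : ∀ v, G.Fl v → (K v).A} {S S' : Species}
    {c : Coc G K b S} (hc : c.IsUniv) (e : S ≅ S') : (c.push e.hom).IsUniv := by
  intro F c'
  obtain ⟨k, ⟨k1, k2⟩, k3⟩ := hc F c'
  have hd : ∀ y, e.inv.app (.op .unit) (e.hom.app _ y) = y := fun y =>
    ConcreteCategory.congr_hom (NatTrans.congr_app e.hom_inv_id (.op El.unit)) y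
  refine ⟨e.inv ≫ k, ⟨fun v => ?_, fun x => ?_⟩, fun l hl => ?_⟩
  · change (c.γ v ≫ e.hom) ≫ e.inv ≫ k = _
    simp [k1]
  · change k.app _ (e.inv.app _ (e.hom.app _ (c.d x))) = _
    rw [hd, k2]
  · rw [← k3 (e.hom ≫ l) ⟨fun v => ?_, fun x => hl.2 x⟩]
    · simp
    · rw [← hl.1 v]
      exact (Category.assoc _ _ _).symm

variable {R Y Z : Gr} (φ : yo.obj R ⟶ bar (yo.obj Y))

/-- Genericity can be computed with any choice of representatives: the given graphs etale over `Y`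
have `Y` as their colimit. -/
lemma isIso_colimMap_iff (K : ∀ v, DGraph (R.Fl v) (yo.obj Y))
    (hK : ∀ v, (K v).cls = ev φ (R.corAt v)) :
    IsIso (colimMap φ) ↔ (cocOf φ K hK).IsUniv := by
  have hr : ∀ v, DGraph.Rel (rep φ v) (K v) := fun v =>
    DGraph.cls_eq.1 ((rep_cls φ v).trans (hK v).symm)
  have hr' : ∀ v, DGraph.Rel (K v) (rep φ v) := fun v =>
    DGraph.cls_eq.1 ((hK v).trans (rep_cls φ v).symm)
  have h1 : IsIso (colimMap φ) ↔ (cocOf φ (rep φ) (rep_cls φ)).IsUniv := by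
    have hq := glueDesc_q (cocOf φ (rep φ) (rep_cls φ))
    have hd := glueDesc_d (cocOf φ (rep φ) (rep_cls φ))
    have hu := glueCoc_isUniv R (fun v => (rep φ v).toNGraph)
    constructor
    · intro h
      refine Coc.isUniv_congr (Coc.push_isUniv hu (yo.mapIso (@asIso _ _ _ _ (colimMap φ) h))) ?_ ?_
      · intro v
        refine Eq.trans ?_ (hq v)
        change _ ≫ yo.map (colimMap φ) = _
        rw [colimMap, yo_unyo]
        rfl
      · intro x
        refine Eq.trans ?_ (hd x)
        change (yo.map (colimMap φ)).app _ _ = _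
        rw [colimMap, yo_unyo]
        rfl
    · intro h
      obtain ⟨e, e1, e2⟩ := Coc.uniq hu h
      have : colimMap φ = e.hom := by
        refine yo_injective ?_
        rw [colimMap, yo_unyo]
        exact Coc.ext_hom hu (fun v => (hq v).trans (e1 v).symm) (fun x => (hd x).trans (e2 x).symm)
      exact this ▸ e.isIso_hom
  rw [h1]
  constructor
  · intro h
    choose f hf hfγ using hr'
    exact Coc.isUniv_congr (Coc.reidx_isUniv (b' := fun v => (K v).port) f hf h) hfγ (fun _ => rfl)
  · intro h
    choose f hf hfγ using hr
    exact Coc.isUniv_congr (Coc.reidx_isUniv (b' := fun v => (rep φ v).port) f hf h) hfγ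
      (fun _ => rfl)

lemma isIso_colimMap_eta : IsIso (colimMap (etaApp (yo.obj R))) := by
  let y : ∀ v, (yo.obj R).obj (.op (R.elAt v)) := fun v => ULift.up (R.corAt v)
  rw [isIso_colimMap_iff _ (fun v => etaFun (R.finite_fl v) (y v)) (fun v => rfl)]
  exact Coc.isUniv_congr (corCoc_isUniv R y) (fun v => rfl) (fun x => rfl)

lemma isIso_colimMap_comp (ψ : yo.obj Y ⟶ bar (yo.obj Z)) (hφ : IsIso (colimMap φ))
    (hψ : IsIso (colimMap ψ)) : IsIso (colimMap (φ ≫ barMap ψ ≫ muApp (yo.obj Z))) := by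
  have hc := (isIso_colimMap_iff φ (rep φ) (rep_cls φ)).1 hφ
  have hcM := (isIso_colimMap_iff ψ (rep ψ) (rep_cls ψ)).1 hψ
  let q : ∀ v, (rep φ v).G ⟶ Y := fun v => unyo (rep φ v).γ
  have hq : ∀ v, yo.map (q v) = (rep φ v).γ := fun v => yo_unyo _
  have hqe : ∀ v, glueQ R (fun v => (rep φ v).toNGraph) v ≫ colimMap φ = q v := by
    intro v
    refine yo_injective ?_
    rw [hq, yo.map_comp, colimMap, yo_unyo]
    exact glueDesc_q (cocOf φ (rep φ) (rep_cls φ)) v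
  have hV : Function.Bijective (fun w : Σ v, (rep φ v).G.V => (q w.1).v w.2) := by
    have h0 : (fun w : Σ v, (rep φ v).G.V => (q w.1).v w.2) = (colimMap φ).v := by
      funext w
      rw [← hqe]; rfl
    rw [h0]
    refine Function.bijective_iff_has_inverse.2 ⟨(inv (colimMap φ)).v, fun w => ?_, fun w => ?_⟩
    · exact congrArg (fun t : colimGraph φ ⟶ colimGraph φ => t.v w)
        (IsIso.hom_inv_id (colimMap φ))
    · exact congrArg (fun t : Y ⟶ Y => t.v w) (IsIso.inv_hom_id (colimMap φ))
  obtain ⟨P, hP, c', h1, h2, h3⟩ := subst_iterate (fun v => (rep φ v).push ψ)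
    (cocOf φ (rep φ) (rep_cls φ)) hc q (fun x => (ev φ (R.arc x)).down.a true)
    (fun v => (hq v).symm) (fun x => congrArg ULift.up (eq_arc _)) hV ψ
    (fun v => congrArg (· ≫ ψ) (hq v)) (rep ψ) (rep_cls ψ) _ hcM
  rw [isIso_colimMap_iff _ P (fun v => ?_)]
  · refine Coc.isUniv_congr h1 (fun v => ?_) (fun x => ?_)
    · rw [← Category.comp_id (c'.γ v)]
      exact h3 (𝟙 _) (fun y => Category.comp_id _) (fun x => rfl) v
    · rw [h2]
      change ev ψ (Y.arc ((ev φ (R.arc x)).down.a true)) = ψ.app _ (ev φ (R.arc x))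
      rw [← eq_arc]
      rfl
  · refine (hP v).trans ?_
    exact congrArg (fun t => muVal (yo.obj Z) (R.elAt v) (barApp ψ (R.elAt v) t)) (rep_cls φ v)

instance : generic.IsMultiplicative where
  id_mem R := isIso_colimMap_eta (R := Subtype.val (p := Gr.NoIsolatedEdges) R)
  comp_mem f g hf hg := isIso_colimMap_comp (KlGr.toBar f) (KlGr.toBar g) hf hg

end generic

/-! The category of Borisov and Manin. -/

/-- A (finite) graph in the sense of Kontsevich and Manin: a set `V` of vertices, a set `F` of
flags, a map `bd : F → V` and an involution `j` of `F`. -/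
structure BMGraph where
  V : Type
  F : Type
  finV : Finite V
  finF : Finite F
  bd : F → V
  j : F → F
  j_j : ∀ f, j (j f) = f

namespace BMGraph

/-- The tails are the fixpoints of the involution. -/
def tails (τ : BMGraph) : Set τ.F := {f | τ.j f = f}

/-- Morphisms `(h^F, h_V, j_h)` of graphs. The fixpoint-free involution `j_h` on the complement of
the image of `h^F` is extended to all flags by letting it fix the image of `h^F` pointwise. -/
@[ext]
structure Hom (τ σ : BMGraph) where
  hF : σ.F → τ.F
  hV : τ.V → σ.V
  jh : τ.F → τ.F
  hF_inj : Function.Injective hF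
  hV_surj : Function.Surjective hV
  /-- The image of `h^F` (and hence its complement) is invariant. -/
  j_mem : ∀ f, τ.j (hF f) ∈ Set.range hF
  jh_jh : ∀ f, jh (jh f) = f
  jh_fix : ∀ f, jh f = f ↔ f ∈ Set.range hF
  /-- On contracted flags, `j_h` agrees with `j_τ` on edges. -/
  jh_edge : ∀ f, f ∉ Set.range hF → τ.j f ≠ f → jh f = τ.j f
  bd_hF : ∀ f, hV (τ.bd (hF f)) = σ.bd f
  /-- The two vertices of a contracted edge, actual or virtual, have the same image. -/
  bd_jh : ∀ f, f ∉ Set.range hF → hV (τ.bd (jh f)) = hV (τ.bd f)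
  /-- Edges of `τ` in the image of `h^F` come from edges of `σ`. -/
  edge : ∀ f, τ.j (hF f) ≠ hF f → hF (σ.j f) = τ.j (hF f)

open Classical in
/-- The involution of a composite: `j_g` on the complement of `g^F`, and `j_c` on the complement
of `c^F`, the latter viewed as a subset of the image of `g^F`. -/
def compJ {τ σ ρ : BMGraph} (g : Hom τ σ) (c : Hom σ ρ) (f : τ.F) : τ.F :=
  if h : f ∈ Set.range g.hF then g.hF (c.jh h.choose) else g.jh f

lemma compJ_hF {τ σ ρ : BMGraph} (g : Hom τ σ) (c : Hom σ ρ) (x : σ.F) :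
    compJ g c (g.hF x) = g.hF (c.jh x) := by
  have h : g.hF x ∈ Set.range g.hF := ⟨x, rfl⟩
  rw [compJ, dif_pos h, g.hF_inj h.choose_spec]

lemma compJ_not {τ σ ρ : BMGraph} (g : Hom τ σ) (c : Hom σ ρ) {f : τ.F}
    (h : f ∉ Set.range g.hF) : compJ g c f = g.jh f := by
  rw [compJ, dif_neg h]

lemma Hom.jh_not {τ σ : BMGraph} (g : Hom τ σ) {f : τ.F} (h : f ∉ Set.range g.hF) :
    g.jh f ∉ Set.range g.hF := by
  intro h'
  have h1 := (g.jh_fix (g.jh f)).2 h'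
  rw [g.jh_jh] at h1
  exact h ((g.jh_fix f).1 h1.symm)

/-- The composite of two morphisms of graphs. -/
def Hom.comp {τ σ ρ : BMGraph} (g : Hom τ σ) (c : Hom σ ρ) : Hom τ ρ where
  hF := g.hF ∘ c.hF
  hV := c.hV ∘ g.hV
  jh := compJ g c
  hF_inj := g.hF_inj.comp c.hF_inj
  hV_surj := c.hV_surj.comp g.hV_surj
  j_mem f := by
    by_cases h : τ.j (g.hF (c.hF f)) = g.hF (c.hF f)
    · exact ⟨f, h.symm⟩
    · obtain ⟨y, hy⟩ := c.j_mem f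
      refine ⟨y, ?_⟩
      change g.hF (c.hF y) = τ.j (g.hF (c.hF f))
      rw [hy, g.edge _ h]
  jh_jh f := by
    by_cases h : f ∈ Set.range g.hF
    · obtain ⟨x, rfl⟩ := h
      rw [compJ_hF, compJ_hF, c.jh_jh]
    · rw [compJ_not g c h, compJ_not g c (g.jh_not h), g.jh_jh]
  jh_fix f := by
    by_cases h : f ∈ Set.range g.hF
    · obtain ⟨x, rfl⟩ := h
      rw [compJ_hF, g.hF_inj.eq_iff, c.jh_fix, Set.range_comp, g.hF_inj.mem_set_image]
    · rw [compJ_not g c h, g.jh_fix]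
      exact ⟨fun h' => (h h').elim, fun ⟨y, hy⟩ => (h ⟨c.hF y, hy⟩).elim⟩
  jh_edge f hf hj := by
    by_cases h : f ∈ Set.range g.hF
    · obtain ⟨x, rfl⟩ := h
      rw [compJ_hF, ← g.edge x hj]
      rw [← g.edge x hj] at hj
      rw [c.jh_edge x (fun ⟨y, hy⟩ => hf ⟨y, by rw [← hy]; rfl⟩) (fun h' => hj (by rw [h']))]
    · rw [compJ_not g c h, g.jh_edge f h hj]
  bd_hF f := by
    change c.hV (g.hV (τ.bd (g.hF (c.hF f)))) = _
    rw [g.bd_hF, c.bd_hF]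
  bd_jh f hf := by
    change c.hV (g.hV _) = c.hV (g.hV _)
    by_cases h : f ∈ Set.range g.hF
    · obtain ⟨x, rfl⟩ := h
      rw [compJ_hF, g.bd_hF, g.bd_hF]
      exact c.bd_jh x (fun ⟨y, hy⟩ => hf ⟨y, by rw [← hy]; rfl⟩)
    · rw [compJ_not g c h, g.bd_jh f h]
  edge f hf := by
    change g.hF (c.hF (ρ.j f)) = τ.j (g.hF (c.hF f))
    have h1 : g.hF (σ.j (c.hF f)) = τ.j (g.hF (c.hF f)) := g.edge _ hf
    have h2 : σ.j (c.hF f) ≠ c.hF f := fun h => hf (by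
      change τ.j (g.hF (c.hF f)) = g.hF (c.hF f)
      rw [← h1, h])
    rw [c.edge f h2, h1]

/-- The category of graphs of Borisov and Manin. -/
instance : Category BMGraph where
  Hom := Hom
  id τ :=
    { hF := id, hV := id, jh := id
      hF_inj := Function.injective_id
      hV_surj := Function.surjective_id
      j_mem := by simp
      jh_jh := by simp
      jh_fix := by simp
      jh_edge := by simp
      bd_hF := by simp
      bd_jh := by simp
      edge := by simp }
  comp g c := g.comp c
  id_comp {τ σ} h := by
    refine Hom.ext rfl rfl (funext fun f => ?_)
    exact compJ_hF (σ := τ) _ h f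
  comp_id {τ σ} h := by
    refine Hom.ext rfl rfl (funext fun f => ?_)
    change compJ h _ f = h.jh f
    by_cases hf : f ∈ Set.range h.hF
    · rw [(h.jh_fix f).2 hf]
      obtain ⟨x, rfl⟩ := hf
      exact compJ_hF h _ x
    · exact compJ_not h _ hf
  assoc {τ σ ρ π} f g h := by
    refine Hom.ext rfl rfl (funext fun x => ?_)
    change compJ (Hom.comp f g) h x = compJ f (Hom.comp g h) x
    by_cases hx : x ∈ Set.range f.hF
    · obtain ⟨x, rfl⟩ := hx
      rw [compJ_hF]
      change _ = f.hF (compJ g h x)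
      by_cases hy : x ∈ Set.range g.hF
      · obtain ⟨x, rfl⟩ := hy
        rw [compJ_hF]
        exact compJ_hF (Hom.comp f g) h x
      · rw [compJ_not g h hy, compJ_not (Hom.comp f g) h]
        · exact compJ_hF f g x
        · rintro ⟨y, hy'⟩
          exact hy ⟨y, f.hF_inj hy'⟩
    · rw [compJ_not f _ hx, compJ_not (Hom.comp f g) h]
      · exact compJ_not f g hx
      · rintro ⟨y, hy⟩
        exact hx ⟨g.hF y, hy⟩

/-- A morphism `h` is a compression if `h^F` is bijective on tails. -/
def compression : MorphismProperty BMGraph :=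
  fun τ σ h => Set.BijOn (Hom.hF h) σ.tails τ.tails

instance : compression.IsMultiplicative where
  id_mem τ := Set.bijOn_id τ.tails
  comp_mem {_ _ _} g c hg hc := Set.BijOn.comp (g := Hom.hF g) (f := Hom.hF c) hg hc

open Classical in
/-- The involution on the arcs of the Joyal-Kock graph associated with a graph. -/
def arcInv (τ : BMGraph) : τ.F ⊕ τ.tails → τ.F ⊕ τ.tails
  | .inl f => if h : τ.j f = f then .inr ⟨f, h⟩ else .inl (τ.j f)
  | .inr t => .inl t.1

/-- The Joyal-Kock graph associated with a graph: same vertices, the flags as half-edges, and as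
arcs the flags and a second copy of each tail, which is a port. The involution interchanges the
flags of an edge, and interchanges a tail with its copy. -/
def toGr (τ : BMGraph) : Gr where
  A := τ.F ⊕ τ.tails
  H := τ.F
  V := τ.V
  finA := by
    have := τ.finF
    infer_instance
  finH := τ.finF
  finV := τ.finV
  i := τ.arcInv
  s := .inl
  p := τ.bd
  i_i := by
    rintro (f | t)
    · by_cases h : τ.j f = f
      · simp [arcInv, h]
      · simp [arcInv, h, τ.j_j]
        exact fun e => (h e.symm).elim
    · have : τ.j t.1 = t.1 := t.2
      simp [arcInv, this]
  i_ne := by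
    rintro (f | t)
    · by_cases h : τ.j f = f
      · simp [arcInv, h]
      · simp [arcInv, h]
    · simp [arcInv]
  s_inj := Sum.inl_injective

lemma toGr_noIsolatedEdges (τ : BMGraph) : τ.toGr.NoIsolatedEdges := by
  rintro (f | t) ⟨h1, h2⟩
  · exact h1 ⟨f, rfl⟩
  · exact h2 ⟨t.1, rfl⟩

/-- The Joyal-Kock graph associated with a graph, as an object of the restricted Kleisli
category. -/
def toKl (τ : BMGraph) : KlGr := (⟨τ.toGr, τ.toGr_noIsolatedEdges⟩ : {G : Gr // G.NoIsolatedEdges})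

end BMGraph

/-- The Kleisli morphism `φ : ρ ⟶ σ` is the refinement which is opposite to `h : σ ⟶ ρ`: on arcs, it
is given by `h^F` (sending the arc of a flag `f` to the arc of the flag `h^F f`), and the graph
etale over `σ` which it assigns to a vertex `x` of `ρ` has as vertices the `h_V`-preimage of `x`. -/
def IsOpposite {σ ρ : BMGraph} (h : σ ⟶ ρ) (φ : ρ.toKl ⟶ σ.toKl) : Prop :=
  (∀ f : ρ.F, ev (KlGr.toBar φ) (ρ.toGr.arc (.inl f)) =
      (⟨σ.toGr.arc (.inl (BMGraph.Hom.hF h f))⟩ : (yo.obj σ.toGr).obj (.op .unit))) ∧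
    ∀ (x : ρ.V) (X : DGraph (ρ.toGr.Fl x) (yo.obj σ.toGr)) (q : X.G ⟶ σ.toGr),
      X.cls = ev (KlGr.toBar φ) (ρ.toGr.corAt x) → X.γ = yo.map q →
        Set.range q.v = BMGraph.Hom.hV h ⁻¹' {x}

end

/-!
A morphism of species `R ⟶ bar Y` is described by a map from the arcs of `R` to the arcs of `Y`
together with a graph etale over `Y` for every vertex of `R`, whose ports lie over the arcs at that
vertex. If a graph etale over `Y` is injective on vertices, then it is determined up to isomorphism
by its set of vertices in `Y` and by the images of its ports: its flags are all the flags of `Y` at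
these vertices, and its ports mark the edges at which it has been cut open.

In a refinement the glued graph is all of `Y`, so the graphs over the vertices of `R` partition the
vertices of `Y`, which is a map `h_V`, while the map on arcs restricts to an injection `h^F` of
flags and to a bijection of ports. Both sides of the equivalence are therefore the same data
`(h^F, h_V)`: a compression has no choice for `j_h`, which has to agree with `j` outside the image
of `h^F`, and conversely the fibres of `h_V`, cut open at the flags in the image of `h^F`, are the
etale graphs of a refinement.
-/

noncomputable section

open Gr

namespace Gr

variable {X Y Z : Gr}

lemma i_injective (X : Gr) : Function.Injective X.i := Function.LeftInverse.injective X.i_i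

namespace Hom

lemma a_i_s (f : X ⟶ Y) (k : X.H) : f.a (X.i (X.s k)) = Y.i (Y.s (f.h k)) := by
  rw [f.a_i, f.a_s]

lemma h_injective_of_v_injective (f : X ⟶ Y) (hv : Function.Injective f.v) :
    Function.Injective f.h := by
  intro x y hxy
  have hp : X.p x = X.p y := hv (by rw [f.v_p, f.v_p, hxy])
  exact (f.cart (X.p y) (f.h y) (f.v_p y).symm).unique ⟨hp, hxy⟩ ⟨rfl, rfl⟩

lemma h_bijective_of_v_bijective (f : X ⟶ Y) (hv : Function.Bijective f.v) :
    Function.Bijective f.h := by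
  refine ⟨f.h_injective_of_v_injective hv.1, fun k => ?_⟩
  obtain ⟨w, hw⟩ := hv.2 (Y.p k)
  obtain ⟨x, hx, -⟩ := f.cart w k hw.symm
  exact ⟨x, hx.2⟩

end Hom

lemma exists_lift_of_range_v_subset (f : X ⟶ Z) (g : Y ⟶ Z)
    (hr : Set.range f.v ⊆ Set.range g.v) :
    ∃ (v : X.V → Y.V) (h : X.H → Y.H), (∀ w, g.v (v w) = f.v w) ∧
      (∀ k, g.h (h k) = f.h k) ∧ ∀ k, v (X.p k) = Y.p (h k) := by
  choose v hv using fun w => hr ⟨w, rfl⟩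
  have hlift : ∀ k, ∃ l, Y.p l = v (X.p k) ∧ g.h l = f.h k := fun k =>
    (g.cart (v (X.p k)) (f.h k) (by rw [hv, f.v_p])).exists
  choose h hp hh using hlift
  exact ⟨v, h, hv, hh, fun k => (hp k).symm⟩

section isIso

lemma isIso_of_bijective (f : X ⟶ Y) (ha : Function.Bijective f.a) (hv : Function.Bijective f.v) :
    IsIso f := by
  obtain ⟨a, hal, har⟩ := Function.bijective_iff_has_inverse.1 ha
  obtain ⟨v, hvl, hvr⟩ := Function.bijective_iff_has_inverse.1 hv
  obtain ⟨h, hhl, hhr⟩ :=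
    Function.bijective_iff_has_inverse.1 (f.h_bijective_of_v_bijective hv)
  let g : Y ⟶ X :=
    { a := a
      h := h
      v := v
      a_i := fun x => ha.1 (by rw [f.a_i, har, har])
      a_s := fun x => ha.1 (by rw [f.a_s, har, hhr])
      v_p := fun x => hv.1 (by rw [f.v_p, hvr, hhr])
      cart := fun w k hk => by
        refine ⟨f.h k, ⟨?_, hhl k⟩, fun y hy => ?_⟩
        · rw [← f.v_p, hk, hvr]
        · rw [← hy.2, hhr] }
  exact ⟨g, Gr.hom_ext hal hhl hvl, Gr.hom_ext har hhr hvr⟩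

lemma a_bijective_of_isIso (f : X ⟶ Y) [IsIso f] : Function.Bijective f.a :=
  Function.bijective_iff_has_inverse.2 ⟨(inv f).a,
    fun w => congrArg (fun t : X ⟶ X => t.a w) (IsIso.hom_inv_id f),
    fun w => congrArg (fun t : Y ⟶ Y => t.a w) (IsIso.inv_hom_id f)⟩

lemma v_bijective_of_isIso (f : X ⟶ Y) [IsIso f] : Function.Bijective f.v :=
  Function.bijective_iff_has_inverse.2 ⟨(inv f).v,
    fun w => congrArg (fun t : X ⟶ X => t.v w) (IsIso.hom_inv_id f),
    fun w => congrArg (fun t : Y ⟶ Y => t.v w) (IsIso.inv_hom_id f)⟩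

lemma h_bijective_of_isIso (f : X ⟶ Y) [IsIso f] : Function.Bijective f.h :=
  f.h_bijective_of_v_bijective (v_bijective_of_isIso f)

lemma isPort_of_isPort_a (f : X ⟶ Y) {a : X.A} (ha : Y.IsPort (f.a a)) : X.IsPort a := by
  rintro ⟨k, rfl⟩
  exact ha ⟨f.h k, (f.a_s k).symm⟩

lemma isPort_a_iff (f : X ⟶ Y) [IsIso f] {a : X.A} : Y.IsPort (f.a a) ↔ X.IsPort a := by
  refine ⟨isPort_of_isPort_a f, fun ha => isPort_of_isPort_a (inv f) ?_⟩
  rwa [← comp_a, IsIso.hom_inv_id, id_a]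

end isIso

namespace NoIsolatedEdges

lemma eq_s_or_eq_i_s (hX : X.NoIsolatedEdges) (a : X.A) :
    (∃ x, a = X.s x) ∨ ∃ x, a = X.i (X.s x) := by
  by_cases h : X.IsPort a
  · obtain ⟨x, hx⟩ := not_not.1 fun h' => hX a ⟨h, h'⟩
    exact .inr ⟨x, by rw [hx, X.i_i]⟩
  · obtain ⟨x, hx⟩ := not_not.1 h
    exact .inl ⟨x, hx.symm⟩

lemma eq_of_eq_on_s (hX : X.NoIsolatedEdges) {d e : X.A → Y.A}
    (hd : ∀ a, d (X.i a) = Y.i (d a)) (he : ∀ a, e (X.i a) = Y.i (e a))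
    (h : ∀ x, d (X.s x) = e (X.s x)) : d = e := by
  funext a
  obtain ⟨x, rfl⟩ | ⟨x, rfl⟩ := hX.eq_s_or_eq_i_s a
  · exact h x
  · rw [hd, he, h]

lemma hom_ext (hX : X.NoIsolatedEdges) {f g : X ⟶ Y}
    (hh : ∀ x, f.h x = g.h x) (hv : ∀ x, f.v x = g.v x) : f = g :=
  Gr.hom_ext (congrFun (hX.eq_of_eq_on_s f.a_i g.a_i fun x => by rw [f.a_s, g.a_s, hh])) hh hv

lemma isIso_of_isPort (hX : X.NoIsolatedEdges) (hY : Y.NoIsolatedEdges) (f : X ⟶ Y)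
    (hv : Function.Bijective f.v) (hp : ∀ a, X.IsPort a → Y.IsPort (f.a a)) : IsIso f := by
  have hh := f.h_bijective_of_v_bijective hv
  have s_eq : ∀ x b, f.a (X.s x) = f.a b → X.s x = b := by
    intro x b e
    by_cases hb : X.IsPort b
    · exact (hp b hb ⟨f.h x, by rw [← e, f.a_s]⟩).elim
    · obtain ⟨y, rfl⟩ := not_not.1 hb
      rw [f.a_s, f.a_s] at e
      rw [hh.1 (Y.s_inj e)]
  refine isIso_of_bijective f ⟨fun a b e => ?_, fun y => ?_⟩ hv
  · obtain ⟨x, rfl⟩ | ⟨x, rfl⟩ := hX.eq_s_or_eq_i_s a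
    · exact s_eq x b e
    · rw [s_eq x (X.i b) (by rw [f.a_i, ← e, f.a_i, Y.i_i]), X.i_i]
  · obtain ⟨k, rfl⟩ | ⟨k, rfl⟩ := hY.eq_s_or_eq_i_s y
    all_goals obtain ⟨x, rfl⟩ := hh.2 k
    · exact ⟨X.s x, f.a_s x⟩
    · exact ⟨X.i (X.s x), f.a_i_s x⟩

section arcsOfFlags

variable (hX : X.NoIsolatedEdges)

open Classical in
/-- The extension of a map on flags to a map on arcs, for a graph without isolated edges. It sends
the arc opposite to that of a flag `k` to the arc opposite to that of `h k`, provided that `h`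
respects the edges joining two flags. -/
def arcsOfFlags (h : X.H → Y.H) (a : X.A) : Y.A :=
  if ha : ∃ k, a = X.s k then Y.s (h ha.choose)
  else Y.i (Y.s (h ((hX.eq_s_or_eq_i_s a).resolve_left ha).choose))

lemma arcsOfFlags_s (h : X.H → Y.H) (k : X.H) : hX.arcsOfFlags h (X.s k) = Y.s (h k) := by
  have hk : ∃ l, X.s k = X.s l := ⟨k, rfl⟩
  rw [arcsOfFlags, dif_pos hk, ← X.s_inj hk.choose_spec]

lemma arcsOfFlags_i_s {h : X.H → Y.H}
    (hi : ∀ k l, X.s l = X.i (X.s k) → Y.s (h l) = Y.i (Y.s (h k))) (k : X.H) :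
    hX.arcsOfFlags h (X.i (X.s k)) = Y.i (Y.s (h k)) := by
  by_cases hk : ∃ l, X.i (X.s k) = X.s l
  · obtain ⟨l, hl⟩ := hk
    rw [hl, arcsOfFlags_s, hi k l hl.symm]
  · have hl := ((hX.eq_s_or_eq_i_s _).resolve_left hk).choose_spec
    rw [arcsOfFlags, dif_neg hk, ← X.s_inj (X.i_injective hl)]

lemma arcsOfFlags_i {h : X.H → Y.H}
    (hi : ∀ k l, X.s l = X.i (X.s k) → Y.s (h l) = Y.i (Y.s (h k))) (a : X.A) :
    hX.arcsOfFlags h (X.i a) = Y.i (hX.arcsOfFlags h a) := by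
  obtain ⟨k, rfl⟩ | ⟨k, rfl⟩ := hX.eq_s_or_eq_i_s a
  · rw [hX.arcsOfFlags_i_s hi, arcsOfFlags_s]
  · rw [hX.arcsOfFlags_i_s hi, X.i_i, arcsOfFlags_s, Y.i_i]

/-- The etale morphism out of a graph without isolated edges given by its maps on flags and on
vertices. -/
def homOfFlags (h : X.H → Y.H) (v : X.V → Y.V)
    (hi : ∀ k l, X.s l = X.i (X.s k) → Y.s (h l) = Y.i (Y.s (h k)))
    (hp : ∀ k, v (X.p k) = Y.p (h k))
    (hc : ∀ w k, Y.p k = v w → ∃! x, X.p x = w ∧ h x = k) : X ⟶ Y where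
  a := hX.arcsOfFlags h
  h := h
  v := v
  a_i := hX.arcsOfFlags_i hi
  a_s := hX.arcsOfFlags_s h
  v_p := hp
  cart := hc

end arcsOfFlags

end NoIsolatedEdges

lemma Effective.nonempty_v (hX : X.Effective) : Nonempty X.V := by
  obtain ⟨⟨⟨a⟩⟩ | h, hX⟩ := hX
  · obtain ⟨x, -⟩ | ⟨x, -⟩ := hX.eq_s_or_eq_i_s a <;> exact ⟨X.p x⟩
  · exact h

end Gr

section etale

variable {n : Type} {Y : Gr}

namespace NGraph

lemma isPort_port (X : NGraph n) (x : n) : X.G.IsPort (X.port x) := (X.β x).2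

lemma exists_port_eq {X : NGraph n} {a : X.G.A} (h : X.G.IsPort a) : ∃ x, X.port x = a :=
  ⟨X.β.symm ⟨a, h⟩, by rw [port, Equiv.apply_symm_apply]⟩

/-- The flag attached to the port `x`. -/
def portFlag (X : NGraph n) (x : n) : X.G.H := (not_not.1 (X.not_port_i x)).choose

lemma s_portFlag (X : NGraph n) (x : n) : X.G.s (X.portFlag x) = X.G.i (X.port x) :=
  (not_not.1 (X.not_port_i x)).choose_spec

lemma i_s_portFlag (X : NGraph n) (x : n) : X.G.i (X.G.s (X.portFlag x)) = X.port x := by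
  rw [s_portFlag, X.G.i_i]

lemma i_s_eq_port_iff {X : NGraph n} {q : X.G ⟶ Y} (hq : Function.Injective q.v) {k : X.G.H}
    {x : n} : X.G.i (X.G.s k) = X.port x ↔ Y.i (Y.s (q.h k)) = q.a (X.port x) := by
  refine ⟨fun h => by rw [← h, q.a_i_s], fun h => ?_⟩
  rw [← i_s_portFlag, q.a_i_s] at h
  rw [← i_s_portFlag, q.h_injective_of_v_injective hq
    (Y.s_inj (Y.i_injective h))]

lemma exists_hom_of_range_v_eq {X X' : NGraph n} {q : X.G ⟶ Y} {q' : X'.G ⟶ Y}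
    (hq : Function.Injective q.v) (hq' : Function.Injective q'.v)
    (hr : Set.range q.v = Set.range q'.v) (hp : ∀ x, q.a (X.port x) = q'.a (X'.port x)) :
    ∃ e : X.G ⟶ X'.G, (∀ x, e.a (X.port x) = X'.port x) ∧ e ≫ q' = q := by
  obtain ⟨v, h, hv, hh, hvp⟩ := exists_lift_of_range_v_subset q q' hr.subset
  have q'_h := q'.h_injective_of_v_injective hq'
  have port_iff : ∀ k x, X'.G.i (X'.G.s (h k)) = X'.port x ↔ X.G.i (X.G.s k) = X.port x :=
    fun k x => by rw [i_s_eq_port_iff hq', i_s_eq_port_iff hq, hh, hp]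
  have inner : ∀ k l, X.G.s l = X.G.i (X.G.s k) → X'.G.s (h l) = X'.G.i (X'.G.s (h k)) := by
    intro k l hkl
    by_cases hk : X'.G.IsPort (X'.G.i (X'.G.s (h k)))
    · obtain ⟨x, hx⟩ := exists_port_eq hk
      exact (X.isPort_port x ⟨l, hkl.trans ((port_iff k x).1 hx.symm)⟩).elim
    · obtain ⟨m, hm⟩ := not_not.1 hk
      rw [← hm, q'_h (Y.s_inj ?_ : q'.h (h l) = q'.h m)]
      rw [← q'.a_s m, hm, q'.a_i_s, hh, hh, ← q.a_s, hkl, q.a_i_s]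
  let e : X.G ⟶ X'.G := X.eff.2.homOfFlags h v inner hvp fun w k hk => by
    obtain ⟨x, ⟨hxp, hx⟩, -⟩ := q.cart w (q'.h k) (by rw [← q'.v_p, hk, hv])
    refine ⟨x, ⟨hxp, q'_h (by rw [hh, hx])⟩, fun y hy => ?_⟩
    exact q.h_injective_of_v_injective hq (by rw [← hh, hy.2, hx])
  refine ⟨e, fun x => ?_, X.eff.2.hom_ext hh hv⟩
  rw [← i_s_portFlag, e.a_i_s]
  exact (port_iff _ x).2 (i_s_portFlag X x)

end NGraph

namespace DGraph

lemma rel_of_range_v_eq {X X' : NGraph n} {q : X.G ⟶ Y} {q' : X'.G ⟶ Y}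
    (hq : Function.Injective q.v) (hq' : Function.Injective q'.v)
    (hr : Set.range q.v = Set.range q'.v) (hp : ∀ x, q.a (X.port x) = q'.a (X'.port x)) :
    DGraph.Rel (⟨X, yo.map q⟩ : DGraph n (yo.obj Y)) ⟨X', yo.map q'⟩ := by
  obtain ⟨e, he_port, he⟩ := NGraph.exists_hom_of_range_v_eq hq hq' hr hp
  have v_comp : ∀ w, q'.v (e.v w) = q.v w := fun w => congrArg (fun t : X.G ⟶ Y => t.v w) he
  have e_v : Function.Bijective e.v := by
    refine ⟨fun w w' hw => hq (by rw [← v_comp, hw, v_comp]), fun w' => ?_⟩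
    obtain ⟨w, hw⟩ : q'.v w' ∈ Set.range q.v := hr ▸ ⟨w', rfl⟩
    exact ⟨w, hq' (by rw [v_comp, hw])⟩
  have : IsIso e := X.eff.2.isIso_of_isPort X'.eff.2 e e_v fun a ha => by
    obtain ⟨x, rfl⟩ := NGraph.exists_port_eq ha
    exact he_port x ▸ X'.isPort_port x
  exact ⟨asIso e, he_port, (yo.map_comp _ _).symm.trans (congrArg yo.map he)⟩

lemma range_v_eq_of_cls_eq {X X' : NGraph n} {q : X.G ⟶ Y} {q' : X'.G ⟶ Y}
    (h : DGraph.cls (⟨X, yo.map q⟩ : DGraph n (yo.obj Y)) = DGraph.cls ⟨X', yo.map q'⟩) :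
    Set.range q.v = Set.range q'.v := by
  obtain ⟨e, -, he⟩ := DGraph.cls_eq.1 h
  have he : e.hom ≫ q' = q := yo_injective ((yo.map_comp _ _).trans he)
  rw [← he]
  exact (Gr.v_bijective_of_isIso e.hom).2.range_comp _

end DGraph

end etale

section universal

instance : yo.Full where
  map_surjective θ := ⟨unyo θ, yo_unyo θ⟩

instance : yo.Faithful where
  map_injective := yo_injective

namespace Coc

variable {G : Gr} {K : G.V → Gr} {b : ∀ v, G.Fl v → (K v).A} {S S' : Species}

lemma push_isUniv_iff {c : Coc G K b S} (hc : c.IsUniv) {k : S ⟶ S'} :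
    (c.push k).IsUniv ↔ IsIso k := by
  refine ⟨fun hk => ?_, fun _ => push_isUniv hc (asIso k)⟩
  obtain ⟨l, ⟨γ_l, d_l⟩, -⟩ := hk S c
  refine ⟨l, ext_hom hc (fun v => ?_) d_l, ext_hom hk (fun v => ?_) fun x => ?_⟩
  · rw [← Category.assoc]
    exact (γ_l v).trans (Category.comp_id _).symm
  · rw [← Category.assoc, γ_l, Category.comp_id]
    rfl
  · exact congrArg (k.app _) (d_l x)

lemma isUniv_iff_isIso_glueDesc {K : ∀ v, NGraph (G.Fl v)}
    (c : Coc G (fun v => (K v).G) (fun v => (K v).port) S) : c.IsUniv ↔ IsIso (glueDesc c) := by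
  rw [← push_isUniv_iff (glueCoc_isUniv G K)]
  exact ⟨fun h => isUniv_congr h (fun v => (glueDesc_q c v).symm) fun a => (glueDesc_d c a).symm,
    fun h => isUniv_congr h (glueDesc_q c) (glueDesc_d c)⟩

end Coc

end universal

/-- A presentation of a morphism of species `R ⟶ bar Y` in terms of graphs and etale morphisms: the
underlying map `d` on arcs, and for each vertex `v` of `R` a graph `q v : K v ⟶ Y` etale over `Y`
which represents its image. -/
structure Presentation {R Y : Gr} (φ : yo.obj R ⟶ bar (yo.obj Y)) where
  d : R.A → Y.A
  K : ∀ v, NGraph (R.Fl v)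
  q : ∀ v, (K v).G ⟶ Y
  ev_arc : ∀ a, ev φ (R.arc a) = (⟨Y.arc (d a)⟩ : (yo.obj Y).obj (.op .unit))
  ev_cor : ∀ v, DGraph.cls ⟨K v, yo.map (q v)⟩ = ev φ (R.corAt v)

namespace Presentation

variable {R Y Z : Gr}

lemma arc_injective {a b : Y.A}
    (h : (⟨Y.arc a⟩ : (yo.obj Y).obj (.op .unit)) = ⟨Y.arc b⟩) : a = b :=
  congrArg (fun t : ULift (El.unit.gr ⟶ Y) => t.down.a true) h

/-- The presentation given by the chosen representatives of the values of `φ`. -/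
def ofRep (φ : yo.obj R ⟶ bar (yo.obj Y)) : Presentation φ where
  d a := (show (yo.obj Y).obj (.op .unit) from ev φ (R.arc a)).down.a true
  K v := (rep φ v).toNGraph
  q v := unyo (rep φ v).γ
  ev_arc a := congrArg ULift.up (eq_arc _)
  ev_cor v := by
    rw [yo_unyo]
    exact rep_cls φ v

/-- The presentation by corollas of the morphism of species given by an etale morphism. -/
def ofHom {φ : yo.obj R ⟶ bar (yo.obj Y)} (f : R ⟶ Y)
    (hφ : φ = yo.map f ≫ etaApp (yo.obj Y)) : Presentation φ where
  d := f.a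
  K v := corN (R.Fl v) (R.finite_fl v)
  q v := R.corAt v ≫ f
  ev_arc a := hφ ▸ congrArg ULift.up (arc_comp a f)
  ev_cor _ := hφ ▸ rfl

section ofMaps

variable {d : R.A → Y.A} {K : ∀ v, NGraph (R.Fl v)} (q : ∀ v, (K v).G ⟶ Y)
  (d_i : ∀ a, d (R.i a) = Y.i (d a))
  (q_port : ∀ v x, (q v).a ((K v).port x) = d (R.i (R.s x.1)))

/-- The cocone under the graphs `K v` given by etale morphisms into `Y` which agree on the arcs
of `R`. -/
def cocOfMaps : Coc R (fun v => (K v).G) (fun v => (K v).port) (yo.obj Y) where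
  γ v := yo.map (q v)
  d a := ⟨Y.arc (d a)⟩
  d_i a := congrArg ULift.up ((congrArg Y.arc (d_i a)).trans (rev_comp_arc _ _).symm)
  compat v x := congrArg ULift.up ((arc_comp _ _).trans (congrArg Y.arc (q_port v x)))

/-- Etale morphisms into `Y` which agree on the arcs of `R` present the morphism of species which
they define. -/
def ofMaps : Presentation (toBar K (cocOfMaps q d_i q_port)) where
  d := d
  K := K
  q := q
  ev_arc _ := rfl
  ev_cor v := (toBar_cor K (cocOfMaps q d_i q_port) v).symm

end ofMaps

variable {φ : yo.obj R ⟶ bar (yo.obj Y)} (P : Presentation φ)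

/-- The decorated graph representing the image of a vertex. -/
abbrev dgraph (v : R.V) : DGraph (R.Fl v) (yo.obj Y) := ⟨P.K v, yo.map (P.q v)⟩

/-- The cocone of the graphs etale over `Y`. -/
abbrev coc : Coc R (fun v => (P.K v).G) (fun v => (P.K v).port) (yo.obj Y) :=
  cocOf φ P.dgraph P.ev_cor

lemma coc_d (a : R.A) : P.coc.d a = ⟨Y.arc (P.d a)⟩ := P.ev_arc a

lemma d_i (a : R.A) : P.d (R.i a) = Y.i (P.d a) := by
  have h := P.coc.d_i a
  rw [coc_d, coc_d] at h
  exact arc_injective (h.trans (congrArg ULift.up (rev_comp_arc _ _)))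

lemma q_port (v : R.V) (x : R.Fl v) : (P.q v).a ((P.K v).port x) = P.d (R.i (R.s x.1)) :=
  arc_injective ((congrArg ULift.up (arc_comp _ _).symm).trans
    ((P.coc.compat v x).trans (P.coc_d _)))

/-- The map on flags underlying the map `d` on arcs. It sends a flag at `v` to the flag of `Y`
carrying the corresponding port of `P.K v`. -/
def flagMap (k : R.H) : Y.H := (P.q (R.p k)).h ((P.K (R.p k)).portFlag ⟨k, rfl⟩)

lemma d_s (k : R.H) : P.d (R.s k) = Y.s (P.flagMap k) := by
  rw [flagMap, ← Gr.Hom.a_s, NGraph.s_portFlag, Gr.Hom.a_i, q_port, P.d_i, Y.i_i]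

lemma d_i_s (k : R.H) : P.d (R.i (R.s k)) = Y.i (Y.s (P.flagMap k)) := by
  rw [P.d_i, d_s]

lemma flagMap_eq_iff {k : R.H} {l : Y.H} : P.flagMap k = l ↔ P.d (R.s k) = Y.s l := by
  rw [d_s, Y.s_inj.eq_iff]

lemma p_flagMap (k : R.H) : Y.p (P.flagMap k) ∈ Set.range (P.q (R.p k)).v :=
  ⟨_, (P.q (R.p k)).v_p _⟩

lemma eq_of_range_v_eq {φ' : yo.obj R ⟶ bar (yo.obj Y)} {P : Presentation φ}
    {P' : Presentation φ'} (hR : R.NoIsolatedEdges) (hq : ∀ v, Function.Injective (P.q v).v)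
    (hq' : ∀ v, Function.Injective (P'.q v).v) (hf : ∀ k, P.flagMap k = P'.flagMap k)
    (hr : ∀ v, Set.range (P.q v).v = Set.range (P'.q v).v) : φ = φ' := by
  have d_eq : P.d = P'.d := hR.eq_of_eq_on_s P.d_i P'.d_i fun k => by rw [d_s, d_s, hf]
  refine dec_ext (fun a => ?_) fun v => ?_
  · rw [P.ev_arc, P'.ev_arc, d_eq]
  · rw [← P.ev_cor, ← P'.ev_cor]
    refine DGraph.cls_eq.2 (DGraph.rel_of_range_v_eq (hq v) (hq' v) (hr v) fun x => ?_)
    rw [P.q_port, P'.q_port, d_eq]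

section ofHom

variable (f : R ⟶ Y) (hφ : φ = yo.map f ≫ etaApp (yo.obj Y))

lemma flagMap_ofHom (k : R.H) : (ofHom f hφ).flagMap k = f.h k :=
  (flagMap_eq_iff _).2 (f.a_s k)

lemma range_ofHom_q_v (v : R.V) : Set.range ((ofHom f hφ).q v).v = {f.v v} :=
  (Set.range_const : Set.range (fun _ : Unit => f.v v) = {f.v v})

end ofHom

section comp

variable {ψ : yo.obj Y ⟶ bar (yo.obj Z)} (Q : Presentation ψ)

/-- The decorated graph over a vertex `w` of `P.K v` given by the presentation `Q` at the image of
`w` in `Y`. -/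
def compFactor (v : R.V) (w : (P.K v).G.V) : DGraph ((P.K v).G.Fl w) (yo.obj Z) :=
  (Q.dgraph ((P.q v).v w)).relabel (equivOf (atMap (P.q v) w))

lemma compFactor_cls (v : R.V) (w : (P.K v).G.V) :
    (P.compFactor Q v w).cls = ev ((P.dgraph v).push ψ).γ ((P.K v).G.corAt w) :=
  rep_pull (P.q v) ψ Q.dgraph Q.ev_cor w

/-- The presentation of the Kleisli composite obtained by substituting the graphs of `Q` into those
of `P`. -/
def comp : Presentation (φ ≫ barMap ψ ≫ muApp (yo.obj Z)) where
  d a := Q.d (P.d a)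
  K v := (subst ((P.dgraph v).push ψ) (P.compFactor Q v) (P.compFactor_cls Q v)).toNGraph
  q v := unyo (subst ((P.dgraph v).push ψ) (P.compFactor Q v) (P.compFactor_cls Q v)).γ
  ev_arc a := (congrArg (fun t => ψ.app (.op .unit) t) (P.ev_arc a)).trans (Q.ev_arc _)
  ev_cor v := by
    rw [yo_unyo]
    refine (mu_subst _ _ (P.compFactor_cls Q v)).symm.trans ?_
    exact congrArg (fun t => muVal (yo.obj Z) (R.elAt v) (barApp ψ (R.elAt v) t)) (P.ev_cor v)

lemma flagMap_comp (k : R.H) : (P.comp Q).flagMap k = Q.flagMap (P.flagMap k) :=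
  (flagMap_eq_iff _).2 ((congrArg Q.d (P.d_s k)).trans (Q.d_s _))

lemma comp_q_v (v : R.V) (w : (P.K v).G.V) (u : (Q.K ((P.q v).v w)).G.V) :
    ((P.comp Q).q v).v (⟨w, u⟩ : Σ w, (P.compFactor Q v w).G.V) = (Q.q ((P.q v).v w)).v u := by
  have glueQ_comp : glueQ (P.K v).G (fun w => (P.compFactor Q v w).toNGraph) w ≫ (P.comp Q).q v =
      Q.q ((P.q v).v w) := by
    refine yo_injective ?_
    refine (yo.map_comp _ _).trans ((congrArg (yo.map _ ≫ ·) (yo_unyo _)).trans ?_)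
    exact glueDesc_q (cocOf ((P.dgraph v).push ψ).γ _ (P.compFactor_cls Q v)) w
  rw [← glueQ_comp]
  rfl

lemma range_comp_q_v (v : R.V) :
    Set.range ((P.comp Q).q v).v = ⋃ w ∈ Set.range (P.q v).v, Set.range (Q.q w).v := by
  rw [Set.biUnion_range]
  ext z
  simp only [Set.mem_iUnion, Set.mem_range]
  constructor
  · rintro ⟨⟨w, u⟩, rfl⟩
    exact ⟨w, u, (P.comp_q_v Q v w u).symm⟩
  · rintro ⟨w, u, rfl⟩
    exact ⟨_, P.comp_q_v Q v w u⟩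

end comp

section glueMap

/-- The etale morphism to `Y` from the graph obtained by gluing the graphs of a presentation. -/
def glueMap : glue R P.K ⟶ Y := unyo (glueDesc P.coc)

lemma glueQ_glueMap (v : R.V) : glueQ R P.K v ≫ P.glueMap = P.q v := by
  refine yo_injective ?_
  rw [yo.map_comp, glueMap, yo_unyo]
  exact glueDesc_q P.coc v

lemma glueMap_v (w : Σ v, (P.K v).G.V) : P.glueMap.v w = (P.q w.1).v w.2 := by
  rw [← P.glueQ_glueMap]; rfl

lemma glueMap_h (k : Σ v, (P.K v).G.H) : P.glueMap.h k = (P.q k.1).h k.2 := by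
  rw [← P.glueQ_glueMap]; rfl

lemma glueMap_a_inl (a : R.A) : P.glueMap.a (.inl a) = P.d a :=
  congrArg (fun t : ULift (El.unit.gr ⟶ Y) => t.down.a true)
    ((glueDesc_d P.coc a).trans (P.coc_d a))

lemma isIso_colimMap_iff : IsIso (colimMap φ) ↔ IsIso P.glueMap := by
  rw [_root_.isIso_colimMap_iff φ P.dgraph P.ev_cor, Coc.isUniv_iff_isIso_glueDesc,
    ← isIso_iff_of_reflects_iso P.glueMap yo, glueMap, yo_unyo]

lemma isIso_glueMap (hR : R.NoIsolatedEdges) (hY : Y.NoIsolatedEdges)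
    (hq : ∀ x, Function.Injective (P.q x).v) {v : Y.V → R.V}
    (hr : ∀ x, Set.range (P.q x).v = v ⁻¹' {x}) (hp : ∀ a, R.IsPort a → Y.IsPort (P.d a)) :
    IsIso P.glueMap := by
  have v_q : ∀ x w, v ((P.q x).v w) = x := fun x w => (hr x).subset ⟨w, rfl⟩
  refine (glue_noIsolatedEdges R P.K hR).isIso_of_isPort hY _ ⟨?_, fun w => ?_⟩ ?_
  · rintro ⟨x, w⟩ ⟨x', w'⟩ e
    rw [P.glueMap_v, P.glueMap_v] at e
    obtain rfl : x = x' := by rw [← v_q x w, e, v_q]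
    exact congrArg (Sigma.mk x) (hq x e)
  · obtain ⟨u, hu⟩ := (hr (v w)).superset rfl
    exact ⟨⟨v w, u⟩, (P.glueMap_v _).trans hu⟩
  · rintro (a | a) ha
    · exact P.glueMap_a_inl a ▸ hp a ((glue_isPort_inl R P.K a).1 ha)
    · exact (glue_isPort_inr R P.K a ha).elim

end glueMap

section isIso

variable [IsIso P.glueMap]

lemma q_v_injective (x : R.V) : Function.Injective (P.q x).v := by
  intro w w' hw
  have h : P.glueMap.v (⟨x, w⟩ : Σ x, (P.K x).G.V) = P.glueMap.v (⟨x, w'⟩ : Σ x, (P.K x).G.V) := by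
    rw [glueMap_v, glueMap_v]
    exact hw
  exact eq_of_heq (Sigma.mk.inj ((Gr.v_bijective_of_isIso P.glueMap).1 h)).2

lemma flagMap_injective : Function.Injective P.flagMap := by
  have d_injective : Function.Injective P.d := fun a b e => Sum.inl.inj
    ((Gr.a_bijective_of_isIso P.glueMap).1 (by rw [glueMap_a_inl, e, glueMap_a_inl]))
  intro k l e
  exact R.s_inj (d_injective (by rw [d_s, e, d_s]))

lemma isPort_d_iff {a : R.A} : Y.IsPort (P.d a) ↔ R.IsPort a :=
  P.glueMap_a_inl a ▸ (Gr.isPort_a_iff P.glueMap).trans (glue_isPort_inl R P.K a)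

lemma exists_d_eq_of_isPort {b : Y.A} (hb : Y.IsPort b) : ∃ a, R.IsPort a ∧ P.d a = b := by
  obtain ⟨a | a, rfl⟩ := (Gr.a_bijective_of_isIso P.glueMap).2 b
  · rw [glueMap_a_inl] at hb ⊢
    exact ⟨a, P.isPort_d_iff.1 hb, rfl⟩
  · exact (glue_isPort_inr R P.K a (Gr.isPort_of_isPort_a _ hb)).elim

/-- The vertex `x` of `R` such that a given vertex of `Y` comes from `P.K x`. -/
def vertexMap (w : Y.V) : R.V :=
  ((Equiv.ofBijective _ (Gr.v_bijective_of_isIso P.glueMap)).symm w : Σ x, (P.K x).G.V).1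

lemma vertexMap_q (x : R.V) (w : (P.K x).G.V) : P.vertexMap ((P.q x).v w) = x := by
  rw [← P.glueMap_v ⟨x, w⟩]
  exact congrArg (fun t : Σ x, (P.K x).G.V => t.1) (Equiv.ofBijective_symm_apply_apply _ _ _)

lemma range_q_v (x : R.V) : Set.range (P.q x).v = P.vertexMap ⁻¹' {x} := by
  ext w
  constructor
  · rintro ⟨u, rfl⟩
    exact P.vertexMap_q x u
  · obtain ⟨⟨y, u⟩, rfl⟩ := (Gr.v_bijective_of_isIso P.glueMap).2 w
    rw [glueMap_v, Set.mem_preimage, vertexMap_q]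
    rintro rfl
    exact ⟨u, rfl⟩

lemma vertexMap_surjective : Function.Surjective P.vertexMap := fun x =>
  let ⟨w⟩ := (P.K x).eff.nonempty_v
  ⟨(P.q x).v w, P.vertexMap_q x w⟩

lemma vertexMap_p_flagMap (k : R.H) : P.vertexMap (Y.p (P.flagMap k)) = R.p k :=
  (P.range_q_v _).subset (P.p_flagMap k)

lemma vertexMap_p_eq_of_notMem_range {k l : Y.H} (hk : k ∉ Set.range P.flagMap)
    (hkl : Y.s l = Y.i (Y.s k)) : P.vertexMap (Y.p l) = P.vertexMap (Y.p k) := by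
  obtain ⟨⟨x, k⟩, rfl⟩ := (Gr.h_bijective_of_isIso P.glueMap).2 k
  rw [glueMap_h] at hk hkl ⊢
  have inner : ¬ (P.K x).G.IsPort ((P.K x).G.i ((P.K x).G.s k)) := fun h => by
    obtain ⟨f, hf⟩ := NGraph.exists_port_eq h
    refine hk ⟨f.1, Y.s_inj (Y.i_injective ?_)⟩
    rw [← d_s, ← P.d_i, ← P.q_port x f, hf, Gr.Hom.a_i_s]
  obtain ⟨m, hm⟩ := not_not.1 inner
  obtain rfl : (P.q x).h m = l := Y.s_inj (by rw [hkl, ← Gr.Hom.a_s, hm, Gr.Hom.a_i_s])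
  rw [← (P.q x).v_p, ← (P.q x).v_p, vertexMap_q, vertexMap_q]

end isIso

end Presentation

namespace BMGraph

variable {σ ρ τ : BMGraph}

section toGr

lemma isPort_inr (t : τ.tails) : τ.toGr.IsPort (.inr t) := by
  rintro ⟨k, hk⟩
  cases hk

lemma not_isPort_inl (f : τ.F) : ¬ τ.toGr.IsPort (.inl f) := fun h => h ⟨f, rfl⟩

lemma toGr_i_s_of_mem_tails {f : τ.F} (hf : f ∈ τ.tails) :
    τ.toGr.i (τ.toGr.s f) = .inr ⟨f, hf⟩ := dif_pos hf

lemma toGr_i_s_of_notMem_tails {f : τ.F} (hf : f ∉ τ.tails) :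
    τ.toGr.i (τ.toGr.s f) = τ.toGr.s (τ.j f) := dif_neg hf

lemma isPort_toGr_i_s_iff {f : τ.F} : τ.toGr.IsPort (τ.toGr.i (τ.toGr.s f)) ↔ f ∈ τ.tails := by
  by_cases hf : f ∈ τ.tails
  · rw [toGr_i_s_of_mem_tails hf]
    exact iff_of_true (isPort_inr _) hf
  · rw [toGr_i_s_of_notMem_tails hf]
    exact iff_of_false (not_isPort_inl _) hf

lemma toGr_s_eq_i_s_iff {f g : τ.F} :
    τ.toGr.s g = τ.toGr.i (τ.toGr.s f) ↔ f ∉ τ.tails ∧ τ.j f = g := by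
  by_cases hf : f ∈ τ.tails
  · exact iff_of_false (fun h => isPort_toGr_i_s_iff.2 hf ⟨g, h⟩) fun h => h.1 hf
  · rw [toGr_i_s_of_notMem_tails hf, and_iff_right hf]
    exact τ.toGr.s_inj.eq_iff.trans eq_comm

end toGr

section compression

lemma Hom.bd_jh_all (h : Hom σ ρ) (f : σ.F) : h.hV (σ.bd (h.jh f)) = h.hV (σ.bd f) := by
  by_cases hf : f ∈ Set.range h.hF
  · rw [(h.jh_fix f).2 hf]
  · exact h.bd_jh f hf

open Classical in
/-- The morphism given by its maps on flags and on vertices, for a map on flags which commutes with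
the involutions and hits all tails. The involution `jh` is then forced: a flag outside the image of
`hF` is no tail, so `jh` agrees with `σ.j` there. -/
def Hom.ofEquivariant (hF : ρ.F → σ.F) (hV : σ.V → ρ.V) (hF_inj : Function.Injective hF)
    (hV_surj : Function.Surjective hV) (j_hF : ∀ f, σ.j (hF f) = hF (ρ.j f))
    (tails_subset : σ.tails ⊆ Set.range hF) (bd_hF : ∀ f, hV (σ.bd (hF f)) = ρ.bd f)
    (bd_j : ∀ f ∉ Set.range hF, hV (σ.bd (σ.j f)) = hV (σ.bd f)) : σ ⟶ ρ where
  hF := hF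
  hV := hV
  jh f := if f ∈ Set.range hF then f else σ.j f
  hF_inj := hF_inj
  hV_surj := hV_surj
  j_mem f := ⟨_, (j_hF f).symm⟩
  jh_jh f := by
    by_cases hf : f ∈ Set.range hF
    · simp only [if_pos hf]
    · have hj : σ.j f ∉ Set.range hF := by
        rintro ⟨g, hg⟩
        exact hf ⟨ρ.j g, by rw [← j_hF, hg, σ.j_j]⟩
      simp only [if_neg hf, if_neg hj, σ.j_j]
  jh_fix f := by
    by_cases hf : f ∈ Set.range hF
    · exact iff_of_true (if_pos hf) hf
    · rw [if_neg hf]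
      exact iff_of_false (fun hj => hf (tails_subset hj)) hf
  jh_edge f hf _ := if_neg hf
  bd_hF := bd_hF
  bd_jh f hf := by
    rw [if_neg hf]
    exact bd_j f hf
  edge f _ := (j_hF f).symm

namespace compression

lemma of_j_hF {h : σ ⟶ ρ} (j_hF : ∀ f, σ.j (Hom.hF h f) = Hom.hF h (ρ.j f))
    (tails_subset : σ.tails ⊆ Set.range (Hom.hF h)) : compression h := by
  refine ⟨fun f hf => (j_hF f).trans (congrArg _ hf), (Hom.hF_inj h).injOn, fun f hf => ?_⟩
  obtain ⟨g, rfl⟩ := tails_subset hf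
  exact ⟨g, Hom.hF_inj h ((j_hF g).symm.trans hf), rfl⟩

variable {h : σ ⟶ ρ} (hc : compression h)
include hc

lemma j_hF (f : ρ.F) : σ.j (Hom.hF h f) = Hom.hF h (ρ.j f) := by
  by_cases hf : Hom.hF h f ∈ σ.tails
  · obtain ⟨t, ht, e⟩ := hc.surjOn hf
    obtain rfl := Hom.hF_inj h e
    rw [hf, show ρ.j t = t from ht]
  · exact (Hom.edge h f hf).symm

lemma jh_eq_j {f : σ.F} (hf : f ∉ Set.range (Hom.hF h)) : Hom.jh h f = σ.j f :=
  Hom.jh_edge h f hf fun hj => hf (Set.image_subset_range _ _ (hc.surjOn hj))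

lemma hF_mem_tails_iff {f : ρ.F} : Hom.hF h f ∈ σ.tails ↔ f ∈ ρ.tails :=
  (congrArg (· = Hom.hF h f) (hc.j_hF f)).to_iff.trans (Hom.hF_inj h).eq_iff

lemma hom_ext {h' : σ ⟶ ρ} (hc' : compression h') (hF : ∀ f, Hom.hF h f = Hom.hF h' f)
    (hV : ∀ w, Hom.hV h w = Hom.hV h' w) : h = h' := by
  have e : Hom.hF h = Hom.hF h' := funext hF
  refine Hom.ext e (funext hV) (funext fun f => ?_)
  by_cases hf : f ∈ Set.range (Hom.hF h)
  · rw [(Hom.jh_fix h f).2 hf, (Hom.jh_fix h' f).2 (e ▸ hf)]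
  · rw [hc.jh_eq_j hf, hc'.jh_eq_j (e ▸ hf)]

lemma s_hF_eq_i_s {k l : ρ.F} (hkl : ρ.toGr.s l = ρ.toGr.i (ρ.toGr.s k)) :
    σ.toGr.s (Hom.hF h l) = σ.toGr.i (σ.toGr.s (Hom.hF h k)) := by
  obtain ⟨hk, rfl⟩ := toGr_s_eq_i_s_iff.1 hkl
  exact toGr_s_eq_i_s_iff.2 ⟨fun hk' => hk (hc.hF_mem_tails_iff.1 hk'), hc.j_hF k⟩

end compression

end compression

section fibre

/-- The graph with vertices `h_V⁻¹(x)` whose edges are the contracted edges over `x`, and whose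
tails are the images of the flags at `x`. -/
def fibre (h : Hom σ ρ) (x : ρ.V) : BMGraph where
  V := {w : σ.V // h.hV w = x}
  F := {f : σ.F // h.hV (σ.bd f) = x}
  finV := by
    have := σ.finV
    infer_instance
  finF := by
    have := σ.finF
    infer_instance
  bd f := ⟨σ.bd f.1, f.2⟩
  j f := ⟨h.jh f.1, (h.bd_jh_all f.1).trans f.2⟩
  j_j f := Subtype.ext (h.jh_jh f.1)

lemma mem_tails_fibre_iff {h : Hom σ ρ} {x : ρ.V} {f : (fibre h x).F} :
    f ∈ (fibre h x).tails ↔ f.1 ∈ Set.range h.hF := by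
  rw [← h.jh_fix]
  exact Subtype.ext_iff

/-- The flag of the fibre over `x` given by a flag at `x`. -/
def fibreFlag (h : Hom σ ρ) {x : ρ.V} (f : ρ.toGr.Fl x) : (fibre h x).F :=
  ⟨h.hF f.1, (h.bd_hF f.1).trans f.2⟩

/-- The fibre over `x` as a graph whose set of ports is the set of flags at `x`. -/
def fibreNGraph (h : Hom σ ρ) (x : ρ.V) : NGraph (ρ.toGr.Fl x) where
  G := (fibre h x).toGr
  eff := by
    obtain ⟨w, hw⟩ := h.hV_surj x
    exact ⟨.inr ⟨⟨w, hw⟩⟩, toGr_noIsolatedEdges _⟩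
  β := Equiv.ofBijective
    (fun f => ⟨.inr ⟨fibreFlag h f, mem_tails_fibre_iff.2 ⟨f.1, rfl⟩⟩, isPort_inr _⟩) <| by
    constructor
    · intro f g e
      have e_flag : fibreFlag h f = fibreFlag h g :=
        congrArg Subtype.val (Sum.inr.inj (congrArg Subtype.val e))
      exact Subtype.ext (h.hF_inj (congrArg Subtype.val e_flag))
    · rintro ⟨f | ⟨f, hf⟩, hp⟩
      · exact (not_isPort_inl f hp).elim
      · obtain ⟨g, hg⟩ := mem_tails_fibre_iff.1 hf
        refine ⟨⟨g, ?_⟩, Subtype.ext (congrArg Sum.inr (Subtype.ext (Subtype.ext hg)))⟩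
        change ρ.bd g = x
        rw [← h.bd_hF, hg, f.2]

lemma fibreNGraph_port (h : Hom σ ρ) (x : ρ.V) (f : ρ.toGr.Fl x) :
    (fibreNGraph h x).port f = (fibre h x).toGr.i ((fibre h x).toGr.s (fibreFlag h f)) :=
  (toGr_i_s_of_mem_tails _).symm

variable {h : σ ⟶ ρ} (hc : compression h)

/-- The inclusion of the fibre over a vertex, as an etale morphism. -/
def fibreMap (x : ρ.V) : (fibreNGraph h x).G ⟶ σ.toGr :=
  (toGr_noIsolatedEdges (fibre h x)).homOfFlags (fun f => f.1) (fun w => w.1)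
    (fun k l hkl => by
      obtain ⟨hk, rfl⟩ := toGr_s_eq_i_s_iff.1 hkl
      have jh_k : Hom.jh h k.1 = σ.j k.1 := hc.jh_eq_j fun hk' => hk (mem_tails_fibre_iff.2 hk')
      exact toGr_s_eq_i_s_iff.2 ⟨fun hj => hk (Subtype.ext (jh_k.trans hj)), jh_k.symm⟩)
    (fun _ => rfl)
    fun w k hk => ⟨⟨k, (congrArg (Hom.hV h) hk).trans w.2⟩, ⟨Subtype.ext hk, rfl⟩,
      fun _ hl => Subtype.ext hl.2⟩

lemma range_fibreMap_v (x : ρ.V) : Set.range (fibreMap hc x).v = Hom.hV h ⁻¹' {x} :=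
  Subtype.range_coe_subtype

end fibre

section refinement

variable {h : σ ⟶ ρ} (hc : compression h)

/-- The map on arcs induced by a compression. -/
def arcMap (h : σ ⟶ ρ) : ρ.toGr.A → σ.toGr.A :=
  ρ.toGr_noIsolatedEdges.arcsOfFlags (Y := σ.toGr) (Hom.hF h)

lemma arcMap_s (h : σ ⟶ ρ) (f : ρ.F) :
    arcMap h (ρ.toGr.s f) = σ.toGr.s (Hom.hF h f) :=
  ρ.toGr_noIsolatedEdges.arcsOfFlags_s (Y := σ.toGr) _ f

include hc in
lemma arcMap_i (a : ρ.toGr.A) : arcMap h (ρ.toGr.i a) = σ.toGr.i (arcMap h a) :=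
  ρ.toGr_noIsolatedEdges.arcsOfFlags_i (fun _ _ => hc.s_hF_eq_i_s) a

lemma fibreMap_port (x : ρ.V) (f : ρ.toGr.Fl x) :
    (fibreMap hc x).a ((fibreNGraph h x).port f) = arcMap h (ρ.toGr.i (ρ.toGr.s f.1)) :=
  calc (fibreMap hc x).a ((fibreNGraph h x).port f)
      = (fibreMap hc x).a ((fibreNGraph h x).G.i ((fibreNGraph h x).G.s (fibreFlag h f))) :=
        congrArg (fibreMap hc x).a (fibreNGraph_port h x f)
    _ = σ.toGr.i (σ.toGr.s (Hom.hF h f.1)) := (fibreMap hc x).a_i_s _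
    _ = σ.toGr.i (arcMap h (ρ.toGr.s f.1)) := congrArg σ.toGr.i (arcMap_s h f.1).symm
    _ = arcMap h (ρ.toGr.i (ρ.toGr.s f.1)) := (arcMap_i hc _).symm

/-- The refinement opposite to a compression: it is given by `h^F` on flags, and assigns to a vertex
the fibre over it. -/
def refinement : ρ.toKl ⟶ σ.toKl :=
  InducedCategory.homMk <| Kleisli.Hom.mk <| toBar (fibreNGraph h) <|
    Presentation.cocOfMaps (R := ρ.toGr) (Y := σ.toGr) (K := fibreNGraph h)
      (fibreMap hc) (arcMap_i hc) (fibreMap_port hc)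

/-- The presentation of the refinement opposite to a compression by the fibres. -/
def refinementPresentation :
    Presentation (R := ρ.toGr) (Y := σ.toGr) (KlGr.toBar (refinement hc)) :=
  Presentation.ofMaps (R := ρ.toGr) (Y := σ.toGr) (K := fibreNGraph h) (fibreMap hc) (arcMap_i hc)
    (fibreMap_port hc)

lemma generic_refinement : generic (refinement hc) := by
  let P := refinementPresentation hc
  have q_injective : ∀ x, Function.Injective (P.q x).v := fun x =>
    (Subtype.val_injective : Function.Injective (fibreMap hc x).v)
  have d_i_s : ∀ f : ρ.F, P.d (ρ.toGr.i (ρ.toGr.s f)) = σ.toGr.i (σ.toGr.s (Hom.hF h f)) :=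
    fun f => (P.d_i _).trans (congrArg σ.toGr.i (arcMap_s h f))
  refine P.isIso_colimMap_iff.2 (P.isIso_glueMap ρ.toGr_noIsolatedEdges σ.toGr_noIsolatedEdges
    (q_injective) (range_fibreMap_v hc) ?_)
  rintro (f | ⟨t, ht⟩) ha
  · exact (not_isPort_inl f ha).elim
  · rw [← toGr_i_s_of_mem_tails ht, d_i_s]
    exact isPort_toGr_i_s_iff.2 (hc.hF_mem_tails_iff.2 ht)

end refinement

end BMGraph

open BMGraph

section opposite

variable {σ ρ : BMGraph} {h : σ ⟶ ρ} {φ : ρ.toKl ⟶ σ.toKl}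

lemma Presentation.isOpposite_iff
    (P : Presentation (R := ρ.toGr) (Y := σ.toGr) (KlGr.toBar φ)) :
    IsOpposite h φ ↔ (∀ f, P.flagMap f = BMGraph.Hom.hF h f) ∧
      ∀ x, Set.range (P.q x).v = BMGraph.Hom.hV h ⁻¹' {x} := by
  refine and_congr (forall_congr' fun f => ?_) (forall_congr' fun x => ⟨fun H => ?_, fun H => ?_⟩)
  · exact Iff.trans ⟨fun H => arc_injective ((P.ev_arc _).symm.trans H),
      fun H => (P.ev_arc _).trans (congrArg (fun a => ULift.up (σ.toGr.arc a)) H)⟩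
      P.flagMap_eq_iff.symm
  · exact H (P.dgraph x) (P.q x) (P.ev_cor x) rfl
  · rintro ⟨X, γ⟩ (q : X.G ⟶ σ.toGr) hX (rfl : γ = yo.map q)
    exact (DGraph.range_v_eq_of_cls_eq (hX.trans (P.ev_cor x).symm)).trans H

lemma isOpposite_refinement (hc : compression h) : IsOpposite h (refinement hc) :=
  (refinementPresentation hc).isOpposite_iff.2
    ⟨fun f => (Presentation.flagMap_eq_iff _).2 (arcMap_s h f), range_fibreMap_v hc⟩

lemma isOpposite_id (σ : BMGraph) : IsOpposite (𝟙 σ) (𝟙 σ.toKl) := by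
  have toBar_id : KlGr.toBar (𝟙 σ.toKl) = yo.map (𝟙 σ.toGr) ≫ etaApp (yo.obj σ.toGr) :=
    (congrArg (· ≫ etaApp (yo.obj σ.toGr)) (yo.map_id σ.toGr)).symm
  exact (Presentation.ofHom (𝟙 σ.toGr) toBar_id).isOpposite_iff.2
    ⟨Presentation.flagMap_ofHom _ toBar_id, Presentation.range_ofHom_q_v _ toBar_id⟩

namespace IsOpposite

lemma comp {τ : BMGraph} {g : τ ⟶ σ} {ψ : σ.toKl ⟶ τ.toKl} (hg : IsOpposite g ψ)
    (hh : IsOpposite h φ) : IsOpposite (g ≫ h) (φ ≫ ψ) := by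
  let P : Presentation (R := ρ.toGr) (Y := σ.toGr) (KlGr.toBar φ) := .ofRep _
  let Q : Presentation (R := σ.toGr) (Y := τ.toGr) (KlGr.toBar ψ) := .ofRep _
  obtain ⟨hF, hV⟩ := P.isOpposite_iff.1 hh
  obtain ⟨gF, gV⟩ := Q.isOpposite_iff.1 hg
  refine (Presentation.isOpposite_iff (φ := φ ≫ ψ) (P.comp Q)).2 ⟨fun f => ?_, fun x => ?_⟩
  · exact (P.flagMap_comp Q f).trans ((congrArg Q.flagMap (hF f)).trans (gF _))
  · have range_eq : ⋃ w ∈ Set.range (P.q x).v, Set.range (Q.q w).v =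
        ⋃ w ∈ BMGraph.Hom.hV h ⁻¹' {x}, BMGraph.Hom.hV g ⁻¹' {w} := by
      rw [hV x]
      exact Set.iUnion₂_congr fun w _ => gV w
    exact (P.range_comp_q_v Q x).trans (range_eq.trans (Set.biUnion_preimage_singleton _ _))

lemma eq_of_generic {φ' : ρ.toKl ⟶ σ.toKl} (ho : IsOpposite h φ) (ho' : IsOpposite h φ')
    (hφ : generic φ) (hφ' : generic φ') : φ = φ' := by
  let P : Presentation (R := ρ.toGr) (Y := σ.toGr) (KlGr.toBar φ) := .ofRep _
  let P' : Presentation (R := ρ.toGr) (Y := σ.toGr) (KlGr.toBar φ') := .ofRep _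
  have := P.isIso_colimMap_iff.1 hφ
  have := P'.isIso_colimMap_iff.1 hφ'
  obtain ⟨flagMap_P, range_P⟩ := P.isOpposite_iff.1 ho
  obtain ⟨flagMap_P', range_P'⟩ := P'.isOpposite_iff.1 ho'
  have e : KlGr.toBar φ = KlGr.toBar φ' :=
    Presentation.eq_of_range_v_eq ρ.toGr_noIsolatedEdges P.q_v_injective P'.q_v_injective
      (fun f => (flagMap_P f).trans (flagMap_P' f).symm)
      fun x => (range_P x).trans (range_P' x).symm
  exact InducedCategory.hom_ext (Kleisli.hom_ext e)

lemma eq_of_compression {h' : σ ⟶ ρ} (ho : IsOpposite h φ) (ho' : IsOpposite h' φ)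
    (hc : compression h) (hc' : compression h') : h = h' := by
  let P : Presentation (R := ρ.toGr) (Y := σ.toGr) (KlGr.toBar φ) := .ofRep _
  obtain ⟨hF, hV⟩ := P.isOpposite_iff.1 ho
  obtain ⟨hF', hV'⟩ := P.isOpposite_iff.1 ho'
  exact hc.hom_ext hc' (fun f => (hF f).symm.trans (hF' f)) fun w =>
    (((hV _).symm.trans (hV' _)).subset rfl : BMGraph.Hom.hV h' w = BMGraph.Hom.hV h w).symm

end IsOpposite

end opposite

section generic

namespace Presentation

variable {σ ρ : BMGraph} {φ : yo.obj ρ.toGr ⟶ bar (yo.obj σ.toGr)} (P : Presentation φ)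
  [IsIso P.glueMap]

lemma flagMap_mem_tails_iff {f : ρ.F} : P.flagMap f ∈ σ.tails ↔ f ∈ ρ.tails := by
  have isPort_iff : σ.toGr.IsPort (σ.toGr.i (σ.toGr.s (P.flagMap f))) ↔
      ρ.toGr.IsPort (ρ.toGr.i (ρ.toGr.s f)) := P.d_i_s f ▸ P.isPort_d_iff
  exact isPort_toGr_i_s_iff.symm.trans (isPort_iff.trans isPort_toGr_i_s_iff)

lemma j_flagMap (f : ρ.F) : σ.j (P.flagMap f) = P.flagMap (ρ.j f) := by
  by_cases hf : f ∈ ρ.tails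
  · rw [show ρ.j f = f from hf]
    exact P.flagMap_mem_tails_iff.2 hf
  · refine (toGr_s_eq_i_s_iff.1 ?_).2
    calc σ.toGr.s (P.flagMap (ρ.j f)) = P.d (ρ.toGr.s (ρ.j f)) := (P.d_s _).symm
      _ = P.d (ρ.toGr.i (ρ.toGr.s f)) := congrArg P.d (toGr_i_s_of_notMem_tails hf).symm
      _ = σ.toGr.i (σ.toGr.s (P.flagMap f)) := P.d_i_s f

lemma tails_subset_range_flagMap : σ.tails ⊆ Set.range P.flagMap := by
  intro f hf
  obtain ⟨a, ha, had⟩ := P.exists_d_eq_of_isPort (isPort_toGr_i_s_iff.2 hf)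
  obtain ⟨k, rfl⟩ | ⟨k, rfl⟩ := ρ.toGr_noIsolatedEdges.eq_s_or_eq_i_s a
  · exact (ha ⟨k, rfl⟩).elim
  · rw [P.d_i_s] at had
    exact ⟨k, σ.toGr.s_inj (σ.toGr.i_injective had)⟩

/-- The compression opposite to a refinement. -/
def toCompression : σ ⟶ ρ :=
  BMGraph.Hom.ofEquivariant P.flagMap P.vertexMap P.flagMap_injective P.vertexMap_surjective
    P.j_flagMap P.tails_subset_range_flagMap P.vertexMap_p_flagMap fun _ hf =>
      P.vertexMap_p_eq_of_notMem_range hf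
        (toGr_s_eq_i_s_iff.2 ⟨fun hj => hf (P.tails_subset_range_flagMap hj), rfl⟩)

lemma compression_toCompression : compression P.toCompression :=
  compression.of_j_hF P.j_flagMap P.tails_subset_range_flagMap

end Presentation

lemma generic.exists_compression {σ ρ : BMGraph} {φ : ρ.toKl ⟶ σ.toKl} (hφ : generic φ) :
    ∃ h : σ ⟶ ρ, compression h ∧ IsOpposite h φ := by
  let P : Presentation (R := ρ.toGr) (Y := σ.toGr) (KlGr.toBar φ) := .ofRep _
  have := P.isIso_colimMap_iff.1 hφ
  exact ⟨P.toCompression, P.compression_toCompression,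
    P.isOpposite_iff.2 ⟨fun _ => rfl, P.range_q_v⟩⟩

end generic

namespace BMGraph

/-- The functor sending a compression to the opposite refinement. -/
def toGeneric : WideSubcategory compression ⥤ (WideSubcategory generic)ᵒᵖ where
  obj σ := .op ⟨σ.obj.toKl⟩
  map h := Quiver.Hom.op ⟨refinement h.property, generic_refinement h.property⟩
  map_id σ := congrArg Quiver.Hom.op <| WideSubcategory.hom_ext _ <|
    (isOpposite_refinement (compression.id_mem σ.obj)).eq_of_generic (isOpposite_id σ.obj)
      (generic_refinement _) (generic.id_mem _)
  map_comp g h := congrArg Quiver.Hom.op <| WideSubcategory.hom_ext _ <|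
    (isOpposite_refinement (compression.comp_mem _ _ g.property h.property)).eq_of_generic
      ((isOpposite_refinement g.property).comp (isOpposite_refinement h.property))
      (generic_refinement _)
      (generic.comp_mem _ _ (generic_refinement h.property) (generic_refinement g.property))

instance : toGeneric.Faithful where
  map_injective {σ ρ g h} e := by
    have refinement_eq : refinement g.property = refinement h.property :=
      congrArg (fun t => t.unop.hom) e
    exact WideSubcategory.hom_ext _ ((isOpposite_refinement g.property).eq_of_compression
      (refinement_eq ▸ isOpposite_refinement h.property) g.property h.property)

instance : toGeneric.Full where
  map_surjective {σ ρ} φ := by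
    obtain ⟨h, hc, ho⟩ := φ.unop.property.exists_compression
    exact ⟨⟨h, hc⟩, congrArg Quiver.Hom.op <| WideSubcategory.hom_ext _ <|
      (isOpposite_refinement hc).eq_of_generic ho (generic_refinement hc) φ.unop.property⟩

section ofGr

variable (R : Gr)

open Classical in
/-- The involution on the flags of a graph which interchanges the two flags of an inner edge and
fixes the flags opposite to a port. -/
def flagInv (k : R.H) : R.H := if h : ∃ l, R.s l = R.i (R.s k) then h.choose else k

variable {R}

lemma flagInv_eq {k l : R.H} (h : R.s l = R.i (R.s k)) : flagInv R k = l := by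
  have hex : ∃ l, R.s l = R.i (R.s k) := ⟨l, h⟩
  rw [flagInv, dif_pos hex]
  exact R.s_inj (hex.choose_spec.trans h.symm)

lemma flagInv_eq_self_iff {k : R.H} : flagInv R k = k ↔ R.IsPort (R.i (R.s k)) := by
  refine ⟨?_, fun h => dif_neg h⟩
  rintro hk ⟨l, hl⟩
  obtain rfl : l = k := (flagInv_eq hl).symm.trans hk
  exact R.i_ne _ hl.symm

lemma flagInv_flagInv (k : R.H) : flagInv R (flagInv R k) = k := by
  by_cases h : R.IsPort (R.i (R.s k))
  · rw [flagInv_eq_self_iff.2 h, flagInv_eq_self_iff.2 h]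
  · obtain ⟨l, hl⟩ := not_not.1 h
    rw [flagInv_eq hl]
    exact flagInv_eq (by rw [hl, R.i_i])

variable (R)

/-- The BM graph with the vertices and flags of a given graph; the tails are the flags opposite to
a port. -/
def ofGr : BMGraph where
  V := R.V
  F := R.H
  finV := R.finV
  finF := R.finH
  bd := R.p
  j := flagInv R
  j_j := flagInv_flagInv

/-- The comparison of a graph with the graph associated with its BM graph, which is the identity on
flags and on vertices. -/
def ofGrMap : (ofGr R).toGr ⟶ R :=
  (toGr_noIsolatedEdges (ofGr R)).homOfFlags id id
    (fun k l hkl => by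
      obtain ⟨hk, rfl⟩ := toGr_s_eq_i_s_iff.1 hkl
      obtain ⟨l, hl⟩ := not_not.1 (mt flagInv_eq_self_iff.2 hk)
      exact (congrArg R.s (flagInv_eq hl)).trans hl)
    (fun _ => rfl) fun _ k hk => ⟨k, ⟨hk, rfl⟩, fun _ hl => hl.2⟩

lemma isIso_ofGrMap (hR : R.NoIsolatedEdges) : IsIso (ofGrMap R) := by
  refine (toGr_noIsolatedEdges (ofGr R)).isIso_of_isPort hR _ Function.bijective_id ?_
  rintro (k | ⟨k, hk⟩) ha
  · exact (not_isPort_inl k ha).elim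
  · rw [← toGr_i_s_of_mem_tails hk]
    exact ((ofGrMap R).a_i_s k).symm ▸ flagInv_eq_self_iff.1 hk

end ofGr

/-- The isomorphism of the restricted Kleisli category given by an isomorphism of graphs. -/
def klIso {R Y : KlGr} (f : R.1 ≅ Y.1) : R ≅ Y :=
  InducedCategory.isoMk ((Kleisli.Adjunction.toKleisli ccp).mapIso (yo.mapIso f))

lemma generic_klIso {R Y : KlGr} (f : R.1 ≅ Y.1) : generic (klIso f).hom := by
  let P := Presentation.ofHom (φ := KlGr.toBar (klIso f).hom) f.hom rfl
  refine P.isIso_colimMap_iff.2 (P.isIso_glueMap R.2 Y.2 (fun _ _ _ _ => rfl) (v := f.inv.v)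
    (fun x => ?_) fun a => (Gr.isPort_a_iff f.hom).2)
  have inv_v_hom_v : ∀ x, f.inv.v (f.hom.v x) = x :=
    fun x => congrArg (fun t : R.1 ⟶ R.1 => t.v x) f.hom_inv_id
  have hom_v_inv_v : ∀ y, f.hom.v (f.inv.v y) = y :=
    fun y => congrArg (fun t : Y.1 ⟶ Y.1 => t.v y) f.inv_hom_id
  refine (Presentation.range_ofHom_q_v _ _ x).trans (Set.ext fun y => ⟨?_, ?_⟩)
  · rintro rfl
    exact inv_v_hom_v x
  · rintro rfl
    exact (hom_v_inv_v y).symm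

instance : toGeneric.EssSurj where
  mem_essImage R := by
    have := isIso_ofGrMap R.unop.obj.1 R.unop.obj.2
    let e : (ofGr R.unop.obj.1).toKl.1 ≅ R.unop.obj.1 := @asIso _ _ _ _ _ this
    exact ⟨⟨ofGr R.unop.obj.1⟩, ⟨(WideSubcategory.isoMk (X := R.unop)
      (Y := ⟨(ofGr R.unop.obj.1).toKl⟩) (klIso e.symm) (generic_klIso e.symm)
      (generic_klIso e)).op⟩⟩

instance : toGeneric.IsEquivalence where

end BMGraph

end

theorem mainTheorem3 :
    ∃ (Φ : WideSubcategory BMGraph.compression ≌ (WideSubcategory generic)ᵒᵖ)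
      (hΦ : ∀ σ : WideSubcategory BMGraph.compression,
        Φ.functor.obj σ = Opposite.op ⟨σ.obj.toKl⟩),
      ∀ (σ ρ : WideSubcategory BMGraph.compression) (h : σ ⟶ ρ),
        IsOpposite h.hom
          (eqToHom (hΦ σ).symm ≫ Φ.functor.map h ≫ eqToHom (hΦ ρ)).unop.hom := by
  refine ⟨BMGraph.toGeneric.asEquivalence, fun _ => rfl, fun σ ρ h => ?_⟩
  have map_eq : eqToHom rfl ≫ BMGraph.toGeneric.map h ≫ eqToHom rfl = BMGraph.toGeneric.map h := by
    simp only [eqToHom_refl, Category.id_comp, Category.comp_id]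
  exact (congrArg (fun t => t.unop.hom) map_eq).symm ▸ isOpposite_refinement h.property
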